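/- **Theorem 2.1.** Let $\mathbb{R}^+=(0,\infty)$. For $T>0$ and a reference temperature $\theta_\infty>0$, an *outer flow* on $[0,T]$ is a triple of $C^2$ functions $U^E,\theta^E,P$ of $(t,x)\in[0,T]\times\mathbb{R}$ with $$\partial_tU^E+U^E\partial_xU^E=-\partial_xP-(\theta^E-\theta_\infty),\qquad \partial_t\theta^E+U^E\partial_x\theta^E=0\qquad(0<t<T).$$ Given an outer flow, a wall temperature $\bar\theta(t,x)$ and initial data $u_0(x,y),\theta_0(x,y)$, consider on $0<t<T$, $x\in\mathbb{R}$, $y>0$ the thermal boundary layer problem $$\begin{cases}\partial_xu+\partial_yv=0,\\ \partial_tu+u\partial_xu+v\partial_yu=\partial_y^2u-\partial_xP-(\theta-\theta_\infty),\\ \partial_t\theta+u\partial_x\theta+v\partial_y\theta=\partial_y^2\theta+(\partial_yu)^2,\\ u|_{y=0}=v|_{y=0}=0,\quad \theta|_{y=0}=\bar\theta,\quad \lim_{y\to\infty}(u,\theta)=(U^E,\theta^E),\\ u|_{t=0}=u_0,\quad \theta|_{t=0}=\theta_0.\end{cases}\tag{1.1}$$ A *solution analytic in $x$ on $[0,T)$*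 means a classical solution $(u,v,\theta)$ of (1.1) such that: $u(t,\cdot,y)$ and $\theta(t,\cdot,y)$ are real-analytic on $\mathbb{R}$ for all $t\in[0,T)$, $y\ge0$; $u,\theta$ are $C^3$ and $v$ is $C^1$ for $0<t<T$, $y>0$; $u,v,\theta,\partial_xu,\partial_x\theta$ are continuous on $[0,T)\times\mathbb{R}\times[0,\infty)$; and $\theta(t,0,y)$, $\partial_x\theta(t,0,y)$, $\partial_yu(t,0,y)$ are bounded on $(0,T']\times\mathbb{R}^+$ for every $T'<T$ (as is the case for solutions of class $H^2$ in $y$, up to the limits at infinity). No bound on $\partial_xu$ is required. There is a continuous function $\mathcal{Y}$ on $[0,\infty)$, positive on $(0,\infty)$ and integrable, with the following property. For all $T>0$ and $C_E,C_P\ge0$ there is a constant $K=K(T,C_E,C_P)$ such that the following holds for every $\theta_\infty>0$, every outer flow on $[0,T]$ with $\partial_xU^E(t,0)\le C_E$ and $-\partial_x^2P(t,0)\le C_P$ for $t\in[0,T]$, and all $\bar\theta,u_0,\theta_0$. Suppose that, for all $t\in[0,T]$ and $y\ge0$, $$U^E(t,0)=0,\qquad \partial_x\theta^E(t,0)\ge0,\tag{2.1}$$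 $$u_0(0,y)=0,\quad \partial_xu_0(0,y)\le0,\quad \partial_x\theta_0(0,y)\ge0,\quad \bar\theta(t,0)+\partial_xP(t,0)=\theta_\infty,\quad \partial_x\bar\theta(t,0)\ge0,\tag{2.2}$$ $$\theta_0(0,y)+\partial_xP(0,0)=\theta_\infty,\tag{2.3}$$ and that the initial data are large in the sense that $$\int_0^\infty\bigl(-\partial_xu_0(0,y)\bigr)\,\mathcal{Y}(y)\,dy\ \ge\ K.$$ Then for every solution $(u,v,\theta)$ of (1.1) analytic in $x$ on $[0,T)$, $\partial_xu$ blows up before time $T$: there is $t_*\in(0,T)$ with $$\sup_{0\le t<t_*,\ y>0}|\partial_xu(t,0,y)|=\infty .$$ (Equivalently, no such solution exists on $[0,T)$ with $\partial_xu(t,0,y)$ bounded on $[0,T']\times\mathbb{R}^+$ for every $T'<T$.) No sign is imposed on $\partial_xP$, so favourable pressure gradients are included. -/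

import Mathlib

open Set Filter Topology MeasureTheory

/-- Time derivative of a function of `(t, x, y)`. -/
noncomputable def partialT (f : ℝ → ℝ → ℝ → ℝ) (t x y : ℝ) : ℝ :=
  deriv (fun t' => f t' x y) t

/-- Tangential derivative of a function of `(t, x, y)`. -/
noncomputable def partialX (f : ℝ → ℝ → ℝ → ℝ) (t x y : ℝ) : ℝ :=
  deriv (fun x' => f t x' y) x

/-- Normal derivative of a function of `(t, x, y)`. -/
noncomputable def partialY (f : ℝ → ℝ → ℝ → ℝ) (t x y : ℝ) : ℝ :=
  deriv (fun y' => f t x y') y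

/-- The open region `{0 < t < T, x ∈ ℝ, y > 0}`. -/
def openRegion (T : ℝ) : Set (ℝ × ℝ × ℝ) := Ioo 0 T ×ˢ (univ ×ˢ Ioi 0)

/-- The region `{0 ≤ t < T, x ∈ ℝ, y ≥ 0}`, with its initial and lateral boundaries. -/
def fullRegion (T : ℝ) : Set (ℝ × ℝ × ℝ) := Ico 0 T ×ˢ (univ ×ˢ Ici 0)

/-- `UE`, `θE`, `P` (functions of `(t, x)`) are the boundary traces of the tangential velocity,
the temperature and the pressure of an outer Euler flow on `[0, T]`: they are of class `C²` and
satisfy `∂ₜUE + UE ∂ₓUE = -∂ₓP - (θE - θref)` and `∂ₜθE + UE ∂ₓθE = 0`. -/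
structure IsOuterFlow (T θref : ℝ) (UE θE P : ℝ → ℝ → ℝ) : Prop where
  contDiff_velocity : ContDiffOn ℝ 2 (fun p : ℝ × ℝ => UE p.1 p.2) (Icc 0 T ×ˢ univ)
  contDiff_temperature : ContDiffOn ℝ 2 (fun p : ℝ × ℝ => θE p.1 p.2) (Icc 0 T ×ˢ univ)
  contDiff_pressure : ContDiffOn ℝ 2 (fun p : ℝ × ℝ => P p.1 p.2) (Icc 0 T ×ˢ univ)
  momentum : ∀ t ∈ Ioo 0 T, ∀ x : ℝ,
    deriv (fun t' => UE t' x) t + UE t x * deriv (UE t) x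
      = - deriv (P t) x - (θE t x - θref)
  transport : ∀ t ∈ Ioo 0 T, ∀ x : ℝ,
    deriv (fun t' => θE t' x) t + UE t x * deriv (θE t) x = 0

/-- The symmetry and sign conditions at `x = 0` on the outer flow, on the boundary temperature
`θb(t, x)` and on the initial data `u₀(x, y)`, `θ₀(x, y)`. -/
structure SymmetrySignConditions (T θref : ℝ) (UE θE P θb u₀ θ₀ : ℝ → ℝ → ℝ) : Prop where
  outer_velocity : ∀ t ∈ Icc 0 T, UE t 0 = 0
  outer_temperature : ∀ t ∈ Icc 0 T, 0 ≤ deriv (θE t) 0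
  initial_velocity : ∀ y : ℝ, 0 ≤ y → u₀ 0 y = 0
  initial_velocity_slope : ∀ y : ℝ, 0 ≤ y → deriv (fun x => u₀ x y) 0 ≤ 0
  initial_temperature : ∀ y : ℝ, 0 ≤ y → θ₀ 0 y + deriv (P 0) 0 = θref
  initial_temperature_slope : ∀ y : ℝ, 0 ≤ y → 0 ≤ deriv (fun x => θ₀ x y) 0
  boundary_temperature : ∀ t ∈ Icc 0 T, θb t 0 + deriv (P t) 0 = θref
  boundary_temperature_slope : ∀ t ∈ Icc 0 T, 0 ≤ deriv (θb t) 0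

/-- `(u, v, θ)` is a classical solution, analytic in `x`, of the thermal boundary layer problem
on `[0, T) × ℝ × ℝ₊` with outer flow `(UE, θE, P)`, wall temperature `θb` and initial data
`(u₀, θ₀)`.

No bound on `∂ₓu` is part of the definition: whether `∂ₓu` stays bounded is the question. -/
structure IsThermalLayerSolution (T θref : ℝ) (UE θE P θb u₀ θ₀ : ℝ → ℝ → ℝ)
    (u v θ : ℝ → ℝ → ℝ → ℝ) : Prop where
  -- analyticity in the tangential variable
  analytic_velocity : ∀ t ∈ Ico 0 T, ∀ y : ℝ, 0 ≤ y →
    AnalyticOnNhd ℝ (fun x => u t x y) univ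
  analytic_temperature : ∀ t ∈ Ico 0 T, ∀ y : ℝ, 0 ≤ y →
    AnalyticOnNhd ℝ (fun x => θ t x y) univ
  -- interior regularity
  contDiff_u : ContDiffOn ℝ 3 (fun p : ℝ × ℝ × ℝ => u p.1 p.2.1 p.2.2) (openRegion T)
  contDiff_v : ContDiffOn ℝ 1 (fun p : ℝ × ℝ × ℝ => v p.1 p.2.1 p.2.2) (openRegion T)
  contDiff_θ : ContDiffOn ℝ 3 (fun p : ℝ × ℝ × ℝ => θ p.1 p.2.1 p.2.2) (openRegion T)
  -- continuity up to `t = 0` and `y = 0`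
  continuous_u : ContinuousOn (fun p : ℝ × ℝ × ℝ => u p.1 p.2.1 p.2.2) (fullRegion T)
  continuous_v : ContinuousOn (fun p : ℝ × ℝ × ℝ => v p.1 p.2.1 p.2.2) (fullRegion T)
  continuous_θ : ContinuousOn (fun p : ℝ × ℝ × ℝ => θ p.1 p.2.1 p.2.2) (fullRegion T)
  continuous_partialX_u :
    ContinuousOn (fun p : ℝ × ℝ × ℝ => partialX u p.1 p.2.1 p.2.2) (fullRegion T)
  continuous_partialX_θ :
    ContinuousOn (fun p : ℝ × ℝ × ℝ => partialX θ p.1 p.2.1 p.2.2) (fullRegion T)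
  -- on the axis `x = 0`, the functions `θ`, `∂ₓθ`, `∂_y u` are bounded in `y`, uniformly on every
  -- compact subinterval of `[0, T)` (as for solutions of class `H²` in `y`)
  bounded_on_axis : ∀ T' ∈ Ioo 0 T, ∃ C : ℝ, ∀ t ∈ Ioc 0 T', ∀ y : ℝ, 0 < y →
    |θ t 0 y| ≤ C ∧ |partialX θ t 0 y| ≤ C ∧ |partialY u t 0 y| ≤ C
  -- the equations
  divergence_free : ∀ t ∈ Ioo 0 T, ∀ x y : ℝ, 0 < y → partialX u t x y + partialY v t x y = 0
  momentum : ∀ t ∈ Ioo 0 T, ∀ x y : ℝ, 0 < y →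
    partialT u t x y + u t x y * partialX u t x y + v t x y * partialY u t x y
      = partialY (partialY u) t x y - deriv (P t) x - (θ t x y - θref)
  heat : ∀ t ∈ Ioo 0 T, ∀ x y : ℝ, 0 < y →
    partialT θ t x y + u t x y * partialX θ t x y + v t x y * partialY θ t x y
      = partialY (partialY θ) t x y + (partialY u t x y) ^ 2
  -- boundary conditions at the wall and at infinity
  wall_u : ∀ t ∈ Ico 0 T, ∀ x : ℝ, u t x 0 = 0
  wall_v : ∀ t ∈ Ico 0 T, ∀ x : ℝ, v t x 0 = 0
  wall_θ : ∀ t ∈ Ico 0 T, ∀ x : ℝ, θ t x 0 = θb t x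
  infinity_u : ∀ t ∈ Ico 0 T, ∀ x : ℝ, Tendsto (fun y => u t x y) atTop (𝓝 (UE t x))
  infinity_θ : ∀ t ∈ Ico 0 T, ∀ x : ℝ, Tendsto (fun y => θ t x y) atTop (𝓝 (θE t x))
  -- initial conditions
  initial_u : ∀ x y : ℝ, 0 ≤ y → u 0 x y = u₀ x y
  initial_θ : ∀ x y : ℝ, 0 ≤ y → θ 0 x y = θ₀ x y

/-!
The blow-up happens on the axis `x = 0`. Suppose that `∂ₓu(t, 0, y)` stays bounded for `t < T / 2`.

On the axis the outer velocity vanishes, so the outer temperature and the pressure gradient are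
constant in time there. The traces `w = u(t, 0, y)` and `Θ = θ(t, 0, y) - const` have zero initial
and wall data; the total energy `Θ + w² / 2` satisfies an equation without the quadratic source
`(∂_y w)²`, and a maximum principle with a quadratic barrier gives `w = Θ = 0`
(`axis_system_eq_zero`, `IsThermalLayerSolution.axis_eq`). Differentiating the heat equation in `x`,
one finds a linear equation for `∂ₓθ` on the axis, and the same maximum principle keeps `∂ₓθ ≥ 0`.
Differentiating the momentum equation, one finds for `b = -∂ₓu(t, 0, y)`, with `b = ∂_y v`,

  `∂ₜb = ∂_y²b - v ∂_y b + b² + ∂ₓ²P + ∂ₓθ ≥ ∂_y²b - v ∂_y b + b² - CP`.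

Now test with the weight `𝒴 = y / (1 + y²)²`. After integration by parts the nonlinear terms become
`∫ 2 b² 𝒴 + v b 𝒴'`, and completing a square against the total derivative of `g v²`, with
`g = -(1 + 3 y²) / (2 (1 + y²)³)`, bounds this from below by `½ ∫ b² 𝒴` (`hardy_identity`). As
`|𝒴''| ≤ 12 𝒴` and `∫ 𝒴 = 1 / 2`, the functional `F = ∫ b 𝒴` satisfies `F' ≥ F² / 2 - C` with `C`
depending on `CP` only, so a large `F(0)` forces `F` to explode before time `T / 2`, although `F` is
bounded (`axis_slope_mass_lt`). No sign or limit at infinity of `b` enters. As `b` is regular only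
inside the layer, the computation is carried out on `[ε, ε + R]`, with the weight corrected by a
linear function so that it vanishes at both ends (`truncated_functional_deriv_ge`).
-/

/-! ### A parabolic maximum principle and a Riccati inequality -/

theorem HasDerivAt.nonneg_of_le_left {h : ℝ → ℝ} {h' a t : ℝ} (hat : a < t)
    (hd : HasDerivAt h h' t) (hle : ∀ s ∈ Ioo a t, h s ≤ h t) : 0 ≤ h' := by
  have h1 : Tendsto (slope h t) (𝓝[<] t) (𝓝 h') :=
    (hasDerivAt_iff_tendsto_slope.1 hd).mono_left (nhdsWithin_mono _ fun s hs => ne_of_lt hs)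
  refine ge_of_tendsto h1 ?_
  filter_upwards [Ioo_mem_nhdsLT hat] with s hs
  rw [slope_def_field]
  exact div_nonneg_of_nonpos (by linarith [hle s hs]) (by linarith [hs.2])

theorem IsLocalMax.second_deriv_nonpos {h h1 : ℝ → ℝ} {h2 y : ℝ} (hm : IsLocalMax h y)
    (hd : ∀ᶠ z in 𝓝 y, HasDerivAt h (h1 z) z) (hd2 : HasDerivAt h1 h2 y) : h2 ≤ 0 := by
  by_contra! hpos
  have hderiv : deriv h =ᶠ[𝓝 y] h1 := hd.mono fun z hz => hz.deriv
  have hmin : IsLocalMin h y := by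
    apply isLocalMin_of_deriv_deriv_pos
    · rwa [hderiv.deriv_eq, hd2.deriv]
    · exact hm.deriv_eq_zero
    · exact hd.self_of_nhds.continuousAt
  have hconst : h =ᶠ[𝓝 y] fun _ => h y := by
    filter_upwards [hm, hmin] with z h3 h4 using le_antisymm h3 h4
  have h5 : deriv (deriv h) y = 0 := by
    have := hconst.deriv.deriv_eq
    simpa using this
  rw [hderiv.deriv_eq, hd2.deriv] at h5
  linarith

/-- Maximum principle on the half-line for `∂ₜ + v ∂_y - ∂_y²` with a transport coefficient of
linear growth. The differential inequality is needed only where `f > 0`, and `f` may grow linearly: at a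
positive maximum of `f / φ`, for the barrier `φ = exp (l t) (1 + y²)` with `l` large, the operator
applied to `f - m φ` is nonnegative. No condition at `y = ∞` beyond the growth bound is needed. -/
theorem parabolic_maximum_principle {τ A B C : ℝ} {v f ft fy fyy : ℝ → ℝ → ℝ} (hB : 0 ≤ B)
    (hv : ∀ t ∈ Ioo 0 τ, ∀ y, 0 < y → |v t y| ≤ B * y)
    (hcont : ContinuousOn (fun p : ℝ × ℝ => f p.1 p.2) (Ico 0 τ ×ˢ Ici 0))
    (hgrowth : ∀ t ∈ Ioo 0 τ, ∀ y, 0 < y → f t y ≤ C * (1 + y))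
    (hinit : ∀ y, 0 ≤ y → f 0 y ≤ 0)
    (hwall : ∀ t ∈ Ico 0 τ, f t 0 ≤ 0)
    (hft : ∀ t ∈ Ioo 0 τ, ∀ y, 0 < y → HasDerivAt (fun s => f s y) (ft t y) t)
    (hfy : ∀ t ∈ Ioo 0 τ, ∀ y, 0 < y → HasDerivAt (f t) (fy t y) y)
    (hfyy : ∀ t ∈ Ioo 0 τ, ∀ y, 0 < y → HasDerivAt (fy t) (fyy t y) y)
    (heq : ∀ t ∈ Ioo 0 τ, ∀ y, 0 < y → 0 < f t y →
      ft t y + v t y * fy t y - fyy t y ≤ A * f t y)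
    {t y : ℝ} (ht : t ∈ Ico 0 τ) (hy : 0 ≤ y) : f t y ≤ 0 := by
  by_contra! hpos
  set l : ℝ := A + 2 * B + 3 with hl
  set φ : ℝ → ℝ → ℝ := fun s z => Real.exp (l * s) * (1 + z ^ 2) with hφ
  have hφpos : ∀ s z, 0 < φ s z := fun s z => by positivity
  set m₀ := f t y / φ t y with hm₀
  have hm₀pos : 0 < m₀ := div_pos hpos (hφpos t y)
  -- beyond the height `R`, the linear bound is beaten by the quadratic barrier
  obtain ⟨R, hyR, hR⟩ : ∃ R, y ≤ R ∧ ∀ s ∈ Ioo 0 τ, ∀ z, R ≤ z → f s z < m₀ * φ s z := by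
    set q := m₀ * Real.exp (-|l| * τ) with hq
    have hqpos : 0 < q := by positivity
    refine ⟨max y (max 1 (2 * |C| / q + 1)), le_max_left _ _, fun s hs z hz => ?_⟩
    have hz1 : 1 ≤ z := le_trans (le_trans (le_max_left _ _) (le_max_right _ _)) hz
    have hz2 : 2 * |C| / q + 1 ≤ z :=
      le_trans (le_trans (le_max_right _ _) (le_max_right _ _)) hz
    have h1 := hgrowth s hs z (by linarith)
    have h2 : 2 * |C| < q * z := by
      have : 2 * |C| / q < z := by linarith
      rw [div_lt_iff₀ hqpos] at this
      linarith
    have h3 : Real.exp (-|l| * τ) ≤ Real.exp (l * s) := by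
      apply Real.exp_le_exp.2
      nlinarith [neg_abs_le l, abs_nonneg l, hs.1, hs.2]
    have h4 : q * (1 + z ^ 2) ≤ m₀ * φ s z := by
      simp only [hq, hφ]
      rw [mul_assoc]
      gcongr
    have h5 : C * (1 + z) ≤ |C| * (2 * z) := by
      nlinarith [le_abs_self C, abs_nonneg C]
    nlinarith [abs_nonneg C]
  -- a point at which the quotient `f / φ` is largest
  set Kset : Set (ℝ × ℝ) := Icc 0 t ×ˢ Icc 0 R
  have hKsub : Kset ⊆ Ico 0 τ ×ˢ Ici 0 := fun p hp =>
    ⟨⟨hp.1.1, hp.1.2.trans_lt ht.2⟩, hp.2.1⟩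
  have hmem : (t, y) ∈ Kset := ⟨⟨ht.1, le_rfl⟩, ⟨hy, hyR⟩⟩
  obtain ⟨⟨s, z⟩, hsz, hmax⟩ : ∃ p ∈ Kset, ∀ r ∈ Kset,
      f r.1 r.2 / φ r.1 r.2 ≤ f p.1 p.2 / φ p.1 p.2 := by
    have hc : ContinuousOn (fun r : ℝ × ℝ => f r.1 r.2 / φ r.1 r.2) Kset := by
      refine (hcont.mono hKsub).div ?_ fun r _ => (hφpos _ _).ne'
      simp only [hφ]
      fun_prop
    exact (isCompact_Icc.prod isCompact_Icc).exists_isMaxOn ⟨_, hmem⟩ hc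
  set m := f s z / φ s z with hm
  have hbound : ∀ r ∈ Kset, f r.1 r.2 ≤ m * φ r.1 r.2 := fun r hr => by
    have := hmax r hr
    rwa [div_le_iff₀ (hφpos _ _)] at this
  have hm₀m : m₀ ≤ m := hmax _ hmem
  have hfk : f s z = m * φ s z := by rw [hm, div_mul_cancel₀ _ (hφpos s z).ne']
  have hmpos : 0 < m := hm₀pos.trans_le hm₀m
  have hfkpos : 0 < f s z := by rw [hfk]; exact mul_pos hmpos (hφpos s z)
  have hs0 : 0 < s := by
    refine lt_of_le_of_ne hsz.1.1 fun h => ?_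
    rw [show s = 0 from h.symm] at hfkpos
    exact hfkpos.not_ge (hinit z hsz.2.1)
  have hsτ : s ∈ Ioo 0 τ := ⟨hs0, hsz.1.2.trans_lt ht.2⟩
  have hz0 : 0 < z := by
    refine lt_of_le_of_ne hsz.2.1 fun h => ?_
    rw [show z = 0 from h.symm] at hfkpos
    exact hfkpos.not_ge (hwall s ⟨hs0.le, hsτ.2⟩)
  have hzR : z < R := by
    by_contra! h
    have h1 := hR s hsτ z h
    have := mul_le_mul_of_nonneg_right hm₀m (hφpos s z).le
    linarith
  -- the conditions of a maximum for `f - m φ`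
  have hφt : HasDerivAt (fun r => φ r z) (l * φ s z) s := by
    have := ((hasDerivAt_id s).const_mul l).exp.mul_const (1 + z ^ 2)
    refine this.congr_deriv ?_
    simp only [hφ, id]
    ring
  have hφy : ∀ x, HasDerivAt (φ s) (Real.exp (l * s) * (2 * x)) x := fun x => by
    have := (((hasDerivAt_id x).pow 2).const_add 1).const_mul (Real.exp (l * s))
    refine this.congr_deriv ?_
    simp
  have hφyy : HasDerivAt (fun x => Real.exp (l * s) * (2 * x)) (Real.exp (l * s) * 2) z := by
    have := ((hasDerivAt_id z).const_mul 2).const_mul (Real.exp (l * s))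
    refine this.congr_deriv ?_
    simp
  have e1 : 0 ≤ ft s z - m * (l * φ s z) := by
    refine HasDerivAt.nonneg_of_le_left hs0 ((hft s hsτ z hz0).sub (hφt.const_mul m)) ?_
    intro r hr
    have := hbound (r, z) ⟨⟨hr.1.le, hr.2.le.trans hsz.1.2⟩, hsz.2⟩
    simp only [Pi.sub_apply]
    simp only at this
    linarith
  have hloc : IsLocalMax (fun x => f s x - m * φ s x) z := by
    filter_upwards [Ioo_mem_nhds hz0 hzR] with x hx
    have := hbound (s, x) ⟨hsz.1, ⟨hx.1.le, hx.2.le⟩⟩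
    simp only at this
    linarith
  have hd1 : ∀ x, 0 < x → HasDerivAt (fun x => f s x - m * φ s x)
      (fy s x - m * (Real.exp (l * s) * (2 * x))) x := fun x hx =>
    (hfy s hsτ x hx).sub ((hφy x).const_mul m)
  have e2 : fy s z - m * (Real.exp (l * s) * (2 * z)) = 0 := hloc.hasDerivAt_eq_zero (hd1 z hz0)
  have e3 : fyy s z - m * (Real.exp (l * s) * 2) ≤ 0 :=
    hloc.second_deriv_nonpos ((lt_mem_nhds hz0).mono hd1)
      ((hfyy s hsτ z hz0).sub (hφyy.const_mul m))
  have e4 := heq s hsτ z hz0 hfkpos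
  have e5 : -(B * z) ≤ v s z := (abs_le.1 (hv s hsτ z hz0)).1
  have hE : 0 < m * Real.exp (l * s) := by positivity
  rw [hfk] at e4
  have e6 : fy s z = m * Real.exp (l * s) * (2 * z) := by linarith
  rw [e6] at e4
  have e7 : m * φ s z = m * Real.exp (l * s) * (1 + z ^ 2) := by simp only [hφ]; ring
  have e8 : m * Real.exp (l * s) * (2 * z) * -(B * z) ≤ m * Real.exp (l * s) * (2 * z) * v s z :=
    mul_le_mul_of_nonneg_left e5 (by positivity)
  have e9 : m * (l * φ s z) = l * (m * Real.exp (l * s) * (1 + z ^ 2)) := by rw [← e7]; ring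
  rw [e9] at e1
  rw [e7] at e4
  have e10 : fyy s z ≤ m * Real.exp (l * s) * 2 := by linarith
  generalize m * Real.exp (l * s) = Q at *
  have e11 : 0 ≤ Q * B := mul_nonneg hE.le hB
  have e12 : 0 ≤ Q * z ^ 2 := by positivity
  rw [hl] at e1
  nlinarith

/-- A function with `F' ≥ F² / 2 - C₁` that starts high enough cannot live up to time `τ`.
Differentiability at time `0` is not assumed, so the comparison starts at a positive time. -/
theorem false_of_riccati_of_large {F F' : ℝ → ℝ} {τ C₁ : ℝ} (hτ : 0 < τ) (hC : 0 < C₁)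
    (hcont : ContinuousOn F (Ico 0 τ)) (hd : ∀ t ∈ Ioo 0 τ, HasDerivAt F (F' t) t)
    (hF' : ∀ t ∈ Ioo 0 τ, F t ^ 2 / 2 - C₁ ≤ F' t) (h0 : 8 / τ + 4 * C₁ + 2 ≤ F 0) : False := by
  -- a starting time at which `F` is still large
  obtain ⟨t₁, ht₁, hFt₁⟩ : ∃ t₁ ∈ Ioo 0 (τ / 4), 8 / τ + 4 * C₁ + 1 < F t₁ := by
    have h1 : ∀ᶠ t in 𝓝[Ico 0 τ] 0, 8 / τ + 4 * C₁ + 1 < F t :=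
      (hcont 0 ⟨le_rfl, hτ⟩).eventually (lt_mem_nhds (by linarith))
    have h2 : 𝓝[Ioo 0 τ] (0 : ℝ) ≤ 𝓝[Ico 0 τ] 0 := nhdsWithin_mono _ Ioo_subset_Ico_self
    rw [nhdsWithin_Ioo_eq_nhdsGT hτ] at h2
    obtain ⟨t, h3, h4⟩ :=
      ((h1.filter_mono h2).and (Ioo_mem_nhdsGT (by linarith : 0 < τ / 4))).exists
    exact ⟨t, h4, h3⟩
  set q := 8 / τ + 4 * C₁ + 1 with hq
  have h8 : 0 < 8 / τ := by positivity
  have hqpos : 0 < q := by positivity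
  -- the solution of `B' = B² / 4` that starts from `q` and explodes at time `s`
  set s := t₁ + 4 / q with hs
  have hsτ : s < τ := by
    have : 4 / q ≤ τ / 2 := by
      rw [div_le_div_iff₀ hqpos two_pos]
      have : 8 / τ * τ = 8 := by field_simp
      nlinarith
    linarith [ht₁.2]
  have hts : t₁ < s := by
    have : 0 < 4 / q := by positivity
    linarith
  have hcomp : ∀ t ∈ Ico t₁ s, 4 / (s - t) ≤ F t := by
    intro t ht
    have hsub : ∀ x ∈ Icc t₁ t, x ∈ Ioo 0 τ := fun x hx =>
      ⟨ht₁.1.trans_le hx.1, hx.2.trans_lt (ht.2.trans hsτ)⟩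
    have key := image_le_of_deriv_right_lt_deriv_boundary' (f := fun x => -F x)
      (f' := fun x => -F' x) (a := t₁) (b := t) (B := fun x => -(4 / (s - x)))
      (B' := fun x => -(4 / (s - x) ^ 2)) 
      ((hcont.mono fun x hx => Ioo_subset_Ico_self (hsub x hx)).neg)
      (fun x hx => (hd x (hsub x ⟨hx.1, hx.2.le⟩)).neg.hasDerivWithinAt)
      (by
        have : s - t₁ = 4 / q := by rw [hs]; ring
        simp only [this]
        rw [div_div_cancel₀ (by norm_num)]
        linarith)
      (by
        refine ContinuousOn.neg (continuousOn_const.div (by fun_prop) fun x hx => ?_)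
        linarith [hx.2, ht.2])
      (fun x hx => by
        have hne : s - x ≠ 0 := by linarith [hx.2, ht.2]
        have := (((hasDerivAt_id x).const_sub s).inv hne).const_mul 4
        refine HasDerivAt.hasDerivWithinAt ?_
        refine (this.neg.congr_of_eventuallyEq ?_).congr_deriv ?_
        · exact Eventually.of_forall fun z => by simp [div_eq_mul_inv]
        · simp [div_eq_mul_inv])
      (fun x hx hxe => by
        have hFx : F x = 4 / (s - x) := by linarith
        have hpos : 0 < s - x := by linarith [hx.2, ht.2]
        have h1 := hF' x (hsub x ⟨hx.1, hx.2.le⟩)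
        have h2 : q ≤ F x := by
          rw [hFx, le_div_iff₀ hpos]
          have : s - x ≤ 4 / q := by linarith [hx.1]
          rw [le_div_iff₀ hqpos] at this
          linarith
        have h3 : 4 / (s - x) ^ 2 = F x ^ 2 / 4 := by
          rw [hFx]; field_simp
        rw [h3]
        nlinarith)
    have := key ⟨ht.1, le_rfl⟩
    linarith
  have hbdd : Tendsto F (𝓝[<] s) (𝓝 (F s)) :=
    (hd s ⟨ht₁.1.trans hts, hsτ⟩).continuousAt.tendsto.mono_left nhdsWithin_le_nhds
  have hinf : Tendsto (fun t => 4 / (s - t)) (𝓝[<] s) atTop := by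
    have h1 : Tendsto (fun t => s - t) (𝓝[<] s) (𝓝[>] 0) := by
      refine tendsto_nhdsWithin_iff.2 ⟨?_, ?_⟩
      · have : Tendsto (fun t => s - t) (𝓝 s) (𝓝 (s - s)) := by
          exact (continuous_const.sub continuous_id).tendsto s
        rw [sub_self] at this
        exact this.mono_left nhdsWithin_le_nhds
      · filter_upwards [self_mem_nhdsWithin] with t ht
        exact sub_pos.2 (mem_Iio.1 ht)
    have := (tendsto_inv_nhdsGT_zero.comp h1).const_mul_atTop (four_pos : (0 : ℝ) < 4)
    simpa [div_eq_mul_inv, Function.comp_def] using this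
  refine not_tendsto_nhds_of_tendsto_atTop (tendsto_atTop_mono' _ ?_ hinf) _ hbdd
  filter_upwards [Ioo_mem_nhdsLT hts] with t ht using hcomp t ⟨ht.1.le, ht.2⟩

/-! ### Partial derivatives of functions of `(t, x, y)` -/

theorem isOpen_openRegion (T : ℝ) : IsOpen (openRegion T) :=
  isOpen_Ioo.prod (isOpen_univ.prod isOpen_Ioi)

theorem mem_openRegion {T t x y : ℝ} (ht : t ∈ Ioo 0 T) (hy : 0 < y) :
    (t, x, y) ∈ openRegion T := ⟨ht, mem_univ _, hy⟩

/-- `f`, as a function of the triple `(t, x, y)`, is of class `C^n` in the interior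
`0 < t < T`, `y > 0` of the layer. -/
def InteriorContDiff (T : ℝ) (n : ℕ∞) (f : ℝ → ℝ → ℝ → ℝ) : Prop :=
  ContDiffOn ℝ n (fun p : ℝ × ℝ × ℝ => f p.1 p.2.1 p.2.2) (openRegion T)

namespace InteriorContDiff

variable {T t x y : ℝ} {n : ℕ∞} {f : ℝ → ℝ → ℝ → ℝ}

theorem contDiffAt (hf : InteriorContDiff T n f) (ht : t ∈ Ioo 0 T) (hy : 0 < y) :
    ContDiffAt ℝ n (fun p : ℝ × ℝ × ℝ => f p.1 p.2.1 p.2.2) (t, x, y) :=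
  ContDiffOn.contDiffAt hf ((isOpen_openRegion T).mem_nhds (mem_openRegion ht hy))

theorem of_le {m : ℕ∞} (hf : InteriorContDiff T n f) (h : m ≤ n) : InteriorContDiff T m f :=
  ContDiffOn.of_le hf (by exact_mod_cast h)

theorem hasFDerivAt (hf : InteriorContDiff T 1 f) (ht : t ∈ Ioo 0 T) (hy : 0 < y) :
    HasFDerivAt (fun p : ℝ × ℝ × ℝ => f p.1 p.2.1 p.2.2)
      (fderiv ℝ (fun p : ℝ × ℝ × ℝ => f p.1 p.2.1 p.2.2) (t, x, y)) (t, x, y) :=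
  ((hf.contDiffAt ht hy).differentiableAt (by simp)).hasFDerivAt

theorem hasDerivAt_t' (hf : InteriorContDiff T 1 f) (ht : t ∈ Ioo 0 T) (hy : 0 < y) :
    HasDerivAt (fun s => f s x y)
      (fderiv ℝ (fun p : ℝ × ℝ × ℝ => f p.1 p.2.1 p.2.2) (t, x, y) (1, 0, 0)) t := by
  have h1 : HasDerivAt (fun s : ℝ => ((s, x, y) : ℝ × ℝ × ℝ)) (1, 0, 0) t :=
    (hasDerivAt_id t).prodMk ((hasDerivAt_const t x).prodMk (hasDerivAt_const t y))
  exact (hf.hasFDerivAt ht hy).comp_hasDerivAt t h1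

theorem hasDerivAt_x' (hf : InteriorContDiff T 1 f) (ht : t ∈ Ioo 0 T) (hy : 0 < y) :
    HasDerivAt (fun s => f t s y)
      (fderiv ℝ (fun p : ℝ × ℝ × ℝ => f p.1 p.2.1 p.2.2) (t, x, y) (0, 1, 0)) x := by
  have h1 : HasDerivAt (fun s : ℝ => ((t, s, y) : ℝ × ℝ × ℝ)) (0, 1, 0) x :=
    (hasDerivAt_const x t).prodMk ((hasDerivAt_id x).prodMk (hasDerivAt_const x y))
  exact (hf.hasFDerivAt ht hy).comp_hasDerivAt x h1

theorem hasDerivAt_y' (hf : InteriorContDiff T 1 f) (ht : t ∈ Ioo 0 T) (hy : 0 < y) :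
    HasDerivAt (fun s => f t x s)
      (fderiv ℝ (fun p : ℝ × ℝ × ℝ => f p.1 p.2.1 p.2.2) (t, x, y) (0, 0, 1)) y := by
  have h1 : HasDerivAt (fun s : ℝ => ((t, x, s) : ℝ × ℝ × ℝ)) (0, 0, 1) y :=
    (hasDerivAt_const y t).prodMk ((hasDerivAt_const y x).prodMk (hasDerivAt_id y))
  exact (hf.hasFDerivAt ht hy).comp_hasDerivAt y h1

theorem hasDerivAt_t (hf : InteriorContDiff T 1 f) (ht : t ∈ Ioo 0 T) (hy : 0 < y) :
    HasDerivAt (fun s => f s x y) (partialT f t x y) t :=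
  (hf.hasDerivAt_t' ht hy).differentiableAt.hasDerivAt

theorem hasDerivAt_x (hf : InteriorContDiff T 1 f) (ht : t ∈ Ioo 0 T) (hy : 0 < y) :
    HasDerivAt (fun s => f t s y) (partialX f t x y) x :=
  (hf.hasDerivAt_x' ht hy).differentiableAt.hasDerivAt

theorem hasDerivAt_y (hf : InteriorContDiff T 1 f) (ht : t ∈ Ioo 0 T) (hy : 0 < y) :
    HasDerivAt (fun s => f t x s) (partialY f t x y) y :=
  (hf.hasDerivAt_y' ht hy).differentiableAt.hasDerivAt

theorem contDiffOn_fderiv_apply {m : ℕ∞} (hf : InteriorContDiff T (m + 1) f) (e : ℝ × ℝ × ℝ) :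
    ContDiffOn ℝ m (fun q => fderiv ℝ (fun p : ℝ × ℝ × ℝ => f p.1 p.2.1 p.2.2) q e)
      (openRegion T) := by
  have h1 : ContDiffOn ℝ m (fderiv ℝ (fun p : ℝ × ℝ × ℝ => f p.1 p.2.1 p.2.2)) (openRegion T) :=
    ContDiffOn.fderiv_of_isOpen hf (isOpen_openRegion T) (by simp)
  exact h1.clm_apply contDiffOn_const

theorem partialT_eq_fderiv (hf : InteriorContDiff T 1 f) (p : ℝ × ℝ × ℝ) (hp : p ∈ openRegion T) :
    _root_.partialT f p.1 p.2.1 p.2.2 =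
      fderiv ℝ (fun p : ℝ × ℝ × ℝ => f p.1 p.2.1 p.2.2) p (1, 0, 0) :=
  (hf.hasDerivAt_t' hp.1 hp.2.2).deriv

theorem partialT {m : ℕ∞} (hf : InteriorContDiff T (m + 1) f) :
    InteriorContDiff T m (partialT f) :=
  (hf.contDiffOn_fderiv_apply (1, 0, 0)).congr
    (hf.of_le le_add_self).partialT_eq_fderiv

theorem partialX_eq_fderiv (hf : InteriorContDiff T 1 f) (p : ℝ × ℝ × ℝ) (hp : p ∈ openRegion T) :
    _root_.partialX f p.1 p.2.1 p.2.2 =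
      fderiv ℝ (fun p : ℝ × ℝ × ℝ => f p.1 p.2.1 p.2.2) p (0, 1, 0) :=
  (hf.hasDerivAt_x' hp.1 hp.2.2).deriv

theorem partialX {m : ℕ∞} (hf : InteriorContDiff T (m + 1) f) :
    InteriorContDiff T m (partialX f) :=
  (hf.contDiffOn_fderiv_apply (0, 1, 0)).congr
    (hf.of_le le_add_self).partialX_eq_fderiv

theorem partialY_eq_fderiv (hf : InteriorContDiff T 1 f) (p : ℝ × ℝ × ℝ) (hp : p ∈ openRegion T) :
    _root_.partialY f p.1 p.2.1 p.2.2 =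
      fderiv ℝ (fun p : ℝ × ℝ × ℝ => f p.1 p.2.1 p.2.2) p (0, 0, 1) :=
  (hf.hasDerivAt_y' hp.1 hp.2.2).deriv

theorem partialY {m : ℕ∞} (hf : InteriorContDiff T (m + 1) f) :
    InteriorContDiff T m (partialY f) :=
  (hf.contDiffOn_fderiv_apply (0, 0, 1)).congr
    (hf.of_le le_add_self).partialY_eq_fderiv

theorem fderiv_fderiv_comm (hf : InteriorContDiff T 2 f) (ht : t ∈ Ioo 0 T) (hy : 0 < y)
    (e e' : ℝ × ℝ × ℝ) :
    fderiv ℝ (fun q => fderiv ℝ (fun p : ℝ × ℝ × ℝ => f p.1 p.2.1 p.2.2) q e) (t, x, y) e' =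
      fderiv ℝ (fun q => fderiv ℝ (fun p : ℝ × ℝ × ℝ => f p.1 p.2.1 p.2.2) q e') (t, x, y) e := by
  have h1 := hf.contDiffAt (x := x) ht hy
  have h2 : DifferentiableAt ℝ (fderiv ℝ (fun p : ℝ × ℝ × ℝ => f p.1 p.2.1 p.2.2)) (t, x, y) :=
    (h1.fderiv_right (m := 1) (by norm_num [one_add_one_eq_two])).differentiableAt (by simp)
  have h3 : IsSymmSndFDerivAt ℝ (fun p : ℝ × ℝ × ℝ => f p.1 p.2.1 p.2.2) (t, x, y) :=
    h1.isSymmSndFDerivAt (by simp)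
  have key : ∀ d d' : ℝ × ℝ × ℝ,
      fderiv ℝ (fun q => fderiv ℝ (fun p : ℝ × ℝ × ℝ => f p.1 p.2.1 p.2.2) q d) (t, x, y) d' =
        fderiv ℝ (fderiv ℝ (fun p : ℝ × ℝ × ℝ => f p.1 p.2.1 p.2.2)) (t, x, y) d' d := by
    intro d d'
    have := (h2.hasFDerivAt.clm_apply (hasFDerivAt_const d _)).fderiv
    rw [this]
    simp
  rw [key, key]
  exact h3 _ _

theorem eventuallyEq_openRegion {g h : ℝ × ℝ × ℝ → ℝ} (heq : ∀ p ∈ openRegion T, g p = h p)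
    (ht : t ∈ Ioo 0 T) (hy : 0 < y) : g =ᶠ[𝓝 (t, x, y)] h :=
  eventually_of_mem ((isOpen_openRegion T).mem_nhds (mem_openRegion ht hy)) heq

theorem partialX_partialT (hf : InteriorContDiff T 2 f) (ht : t ∈ Ioo 0 T) (hy : 0 < y) :
    _root_.partialX (_root_.partialT f) t x y = _root_.partialT (_root_.partialX f) t x y := by
  have hf1 : InteriorContDiff T 1 f := hf.of_le (by norm_num)
  have hf2 : InteriorContDiff T (1 + 1) f := hf.of_le (by norm_num)
  have e1 := (hf2.partialT.hasDerivAt_x' (x := x) ht hy).deriv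
  have e2 := (hf2.partialX.hasDerivAt_t' (x := x) ht hy).deriv
  rw [(eventuallyEq_openRegion hf1.partialT_eq_fderiv ht hy).fderiv_eq]
    at e1
  rw [(eventuallyEq_openRegion hf1.partialX_eq_fderiv ht hy).fderiv_eq]
    at e2
  exact e1.trans ((hf.fderiv_fderiv_comm ht hy _ _).trans e2.symm)

theorem partialX_partialY (hf : InteriorContDiff T 2 f) (ht : t ∈ Ioo 0 T) (hy : 0 < y) :
    _root_.partialX (_root_.partialY f) t x y = _root_.partialY (_root_.partialX f) t x y := by
  have hf1 : InteriorContDiff T 1 f := hf.of_le (by norm_num)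
  have hf2 : InteriorContDiff T (1 + 1) f := hf.of_le (by norm_num)
  have e1 := (hf2.partialY.hasDerivAt_x' (x := x) ht hy).deriv
  have e2 := (hf2.partialX.hasDerivAt_y' (x := x) ht hy).deriv
  rw [(eventuallyEq_openRegion hf1.partialY_eq_fderiv ht hy).fderiv_eq]
    at e1
  rw [(eventuallyEq_openRegion hf1.partialX_eq_fderiv ht hy).fderiv_eq]
    at e2
  exact e1.trans ((hf.fderiv_fderiv_comm ht hy _ _).trans e2.symm)

theorem partialX_partialY_partialY (hf : InteriorContDiff T 3 f) (ht : t ∈ Ioo 0 T) (hy : 0 < y) :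
    _root_.partialX (_root_.partialY (_root_.partialY f)) t x y =
      _root_.partialY (_root_.partialY (_root_.partialX f)) t x y := by
  have hf3 : InteriorContDiff T (2 + 1) f := hf.of_le (by norm_num)
  rw [hf3.partialY.partialX_partialY ht hy]
  refine EventuallyEq.deriv_eq ?_
  filter_upwards [lt_mem_nhds hy] with z hz using (hf.of_le (by norm_num)).partialX_partialY ht hz

end InteriorContDiff

/-! ### Uniqueness for the traces on the axis -/

theorem abs_le_mul_of_hasDerivAt {h h' : ℝ → ℝ} {N : ℝ} (hc : ContinuousOn h (Ici 0))
    (h0 : h 0 = 0) (hd : ∀ y, 0 < y → HasDerivAt h (h' y) y) (hN : ∀ y, 0 < y → |h' y| ≤ N)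
    {y : ℝ} (hy : 0 < y) : |h y| ≤ N * y := by
  obtain ⟨z, hz, he⟩ := exists_hasDerivAt_eq_slope h h' hy (hc.mono Icc_subset_Ici_self)
    fun x hx => hd x hx.1
  rw [h0, sub_zero, sub_zero, eq_div_iff hy.ne'] at he
  rw [← he, abs_mul, abs_of_pos hy]
  exact mul_le_mul_of_nonneg_right (hN z hz.1) hy.le

section AxisSystem

variable {τ M N : ℝ} {w wt wy wyy Θ Θt Θy Θyy a η v : ℝ → ℝ → ℝ}

/-- A priori bound for `w`: the wall condition and `|∂_y w| ≤ N` give linear growth only, and the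
maximum principle for `±w - N exp ((M + 1) t)` improves this to boundedness. -/
theorem axis_velocity_bounded (hM : 0 ≤ M) (hN : 0 ≤ N)
    (hv : ∀ t ∈ Ioo 0 τ, ∀ y, 0 < y → |v t y| ≤ M * y)
    (hwc : ContinuousOn (fun p : ℝ × ℝ => w p.1 p.2) (Ico 0 τ ×ˢ Ici 0))
    (hw0 : ∀ y, 0 ≤ y → w 0 y = 0) (hww : ∀ t ∈ Ico 0 τ, w t 0 = 0)
    (ha : ∀ t ∈ Ioo 0 τ, ∀ y, 0 < y → |a t y| ≤ M)
    (hΘ : ∀ t ∈ Ioo 0 τ, ∀ y, 0 < y → |Θ t y| ≤ N)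
    (hwyb : ∀ t ∈ Ioo 0 τ, ∀ y, 0 < y → |wy t y| ≤ N)
    (hwt : ∀ t ∈ Ioo 0 τ, ∀ y, 0 < y → HasDerivAt (fun s => w s y) (wt t y) t)
    (hwy : ∀ t ∈ Ioo 0 τ, ∀ y, 0 < y → HasDerivAt (w t) (wy t y) y)
    (hwyy : ∀ t ∈ Ioo 0 τ, ∀ y, 0 < y → HasDerivAt (wy t) (wyy t y) y)
    (hweq : ∀ t ∈ Ioo 0 τ, ∀ y, 0 < y →
      wt t y + w t y * a t y + v t y * wy t y = wyy t y - Θ t y) :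
    ∃ W, 0 ≤ W ∧ ∀ t ∈ Ico 0 τ, ∀ y, 0 ≤ y → |w t y| ≤ W := by
  set e : ℝ → ℝ := fun t => N * Real.exp ((M + 1) * t) with he
  have he0 : ∀ t, 0 ≤ e t := fun t => by positivity
  have hed : ∀ t, HasDerivAt e ((M + 1) * e t) t := fun t => by
    have := (((hasDerivAt_id t).const_mul (M + 1)).exp).const_mul N
    refine this.congr_deriv ?_
    simp only [he, id]
    ring
  have key : ∀ σ : ℝ, |σ| = 1 → ∀ t ∈ Ico 0 τ, ∀ y, 0 ≤ y → σ * w t y - e t ≤ 0 := by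
    intro σ hσ t ht y hy
    refine parabolic_maximum_principle (A := M) (C := N) (B := M) (v := v)
      (f := fun t y => σ * w t y - e t) (ft := fun t y => σ * wt t y - (M + 1) * e t)
      (fy := fun t y => σ * wy t y) (fyy := fun t y => σ * wyy t y) hM hv ?_ ?_ ?_ ?_ ?_ ?_ ?_ ?_
      ht hy
    · refine (hwc.const_smul σ).sub ?_
      simp only [he]
      fun_prop
    · intro t ht y hy
      have h1 : |w t y| ≤ N * y := by
        refine abs_le_mul_of_hasDerivAt (h' := wy t) ?_ (hww t ⟨ht.1.le, ht.2⟩) (hwy t ht)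
          (hwyb t ht) hy
        exact hwc.comp (f := fun y : ℝ => (t, y)) (by fun_prop) fun y hy => ⟨⟨ht.1.le, ht.2⟩, hy⟩
      have h2 : σ * w t y ≤ |w t y| := by
        calc σ * w t y ≤ |σ * w t y| := le_abs_self _
          _ = |w t y| := by rw [abs_mul, hσ, one_mul]
      have := he0 t
      linarith
    · intro y hy
      rw [hw0 y hy]
      linarith [he0 0]
    · intro t ht
      rw [hww t ht]
      linarith [he0 t]
    · intro t ht y hy
      exact ((hwt t ht y hy).const_mul σ).sub (hed t)
    · intro t ht y hy
      exact ((hwy t ht y hy).const_mul σ).sub_const _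
    · intro t ht y hy
      exact (hwyy t ht y hy).const_mul σ
    · intro t ht y hy hpos
      have h1 : σ * wt t y + v t y * (σ * wy t y) - σ * wyy t y
          = σ * w t y * (-a t y) + σ * (-Θ t y) := by
        linear_combination σ * hweq t ht y hy
      have h2 : 0 < σ * w t y := by linarith [he0 t]
      have h3 : σ * w t y * (-a t y) ≤ σ * w t y * M :=
        mul_le_mul_of_nonneg_left (by linarith [(abs_le.1 (ha t ht y hy)).1]) h2.le
      have h4 : σ * (-Θ t y) ≤ N := by
        calc σ * (-Θ t y) ≤ |σ * (-Θ t y)| := le_abs_self _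
          _ = |Θ t y| := by rw [abs_mul, hσ, one_mul, abs_neg]
          _ ≤ N := hΘ t ht y hy
      have h5 : N ≤ e t := by
        have : 1 ≤ Real.exp ((M + 1) * t) := by
          exact Real.one_le_exp (mul_nonneg (by linarith) ht.1.le)
        exact le_mul_of_one_le_right hN this
      linarith
  refine ⟨N * Real.exp ((M + 1) * |τ|), by positivity, fun t ht y hy => ?_⟩
  have h1 := key 1 (by simp) t ht y hy
  have h2 := key (-1) (by simp) t ht y hy
  have h3 : e t ≤ N * Real.exp ((M + 1) * |τ|) := by
    simp only [he]
    have : t ≤ |τ| := ht.2.le.trans (le_abs_self τ)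
    gcongr
  rw [abs_le]
  constructor <;> linarith

/-- Uniqueness of the zero solution for the trace on the axis of the velocity `w` and of the
temperature `Θ`, relative to its constant value. The source `(∂_y w)²` of the heat equation
disappears from the equation of the total energy `H = Θ + w² / 2`, so that `(w, H)` solves a system
coupled through bounded zeroth order terms, and the maximum principle applies to `w² + H²`. -/
theorem axis_system_eq_zero (hM : 0 ≤ M) (hN : 0 ≤ N)
    (hv : ∀ t ∈ Ioo 0 τ, ∀ y, 0 < y → |v t y| ≤ M * y)
    (hwc : ContinuousOn (fun p : ℝ × ℝ => w p.1 p.2) (Ico 0 τ ×ˢ Ici 0))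
    (hΘc : ContinuousOn (fun p : ℝ × ℝ => Θ p.1 p.2) (Ico 0 τ ×ˢ Ici 0))
    (hw0 : ∀ y, 0 ≤ y → w 0 y = 0) (hww : ∀ t ∈ Ico 0 τ, w t 0 = 0)
    (hΘ0 : ∀ y, 0 ≤ y → Θ 0 y = 0) (hΘw : ∀ t ∈ Ico 0 τ, Θ t 0 = 0)
    (ha : ∀ t ∈ Ioo 0 τ, ∀ y, 0 < y → |a t y| ≤ M)
    (hη : ∀ t ∈ Ioo 0 τ, ∀ y, 0 < y → |η t y| ≤ N)
    (hΘ : ∀ t ∈ Ioo 0 τ, ∀ y, 0 < y → |Θ t y| ≤ N)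
    (hwyb : ∀ t ∈ Ioo 0 τ, ∀ y, 0 < y → |wy t y| ≤ N)
    (hwt : ∀ t ∈ Ioo 0 τ, ∀ y, 0 < y → HasDerivAt (fun s => w s y) (wt t y) t)
    (hwy : ∀ t ∈ Ioo 0 τ, ∀ y, 0 < y → HasDerivAt (w t) (wy t y) y)
    (hwyy : ∀ t ∈ Ioo 0 τ, ∀ y, 0 < y → HasDerivAt (wy t) (wyy t y) y)
    (hΘt : ∀ t ∈ Ioo 0 τ, ∀ y, 0 < y → HasDerivAt (fun s => Θ s y) (Θt t y) t)
    (hΘy : ∀ t ∈ Ioo 0 τ, ∀ y, 0 < y → HasDerivAt (Θ t) (Θy t y) y)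
    (hΘyy : ∀ t ∈ Ioo 0 τ, ∀ y, 0 < y → HasDerivAt (Θy t) (Θyy t y) y)
    (hweq : ∀ t ∈ Ioo 0 τ, ∀ y, 0 < y →
      wt t y + w t y * a t y + v t y * wy t y = wyy t y - Θ t y)
    (hΘeq : ∀ t ∈ Ioo 0 τ, ∀ y, 0 < y →
      Θt t y + w t y * η t y + v t y * Θy t y = Θyy t y + wy t y ^ 2)
    {t y : ℝ} (ht : t ∈ Ico 0 τ) (hy : 0 ≤ y) : w t y = 0 ∧ Θ t y = 0 := by
  obtain ⟨W, hW0, hW⟩ := axis_velocity_bounded hM hN hv hwc hw0 hww ha hΘ hwyb hwt hwy hwyy hweq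
  set H : ℝ → ℝ → ℝ := fun t y => Θ t y + w t y ^ 2 / 2 with hH
  have key : w t y ^ 2 + H t y ^ 2 ≤ 0 := by
    refine parabolic_maximum_principle (A := 2 * M + 1 + W + (2 * N + W * M))
      (C := W ^ 2 + (N + W ^ 2 / 2) ^ 2) (B := M) (v := v)
      (f := fun t y => w t y ^ 2 + H t y ^ 2)
      (ft := fun t y => 2 * w t y * wt t y + 2 * H t y * (Θt t y + w t y * wt t y))
      (fy := fun t y => 2 * w t y * wy t y + 2 * H t y * (Θy t y + w t y * wy t y))
      (fyy := fun t y => 2 * (wy t y * wy t y + w t y * wyy t y) +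
        2 * ((Θy t y + w t y * wy t y) * (Θy t y + w t y * wy t y) +
          H t y * (Θyy t y + (wy t y * wy t y + w t y * wyy t y))))
      hM hv ?_ ?_ ?_ ?_ ?_ ?_ ?_ ?_ ht hy
    · exact (hwc.pow 2).add ((hΘc.add ((hwc.pow 2).div_const 2)).pow 2)
    · intro t ht y hy
      have h1 := hW t ⟨ht.1.le, ht.2⟩ y hy.le
      have h2 := hΘ t ht y hy
      have h3 : w t y ^ 2 ≤ W ^ 2 := sq_le_sq' (abs_le.1 h1).1 (abs_le.1 h1).2
      have h4 : |H t y| ≤ N + W ^ 2 / 2 := by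
        rw [abs_le] at h2 ⊢
        simp only [hH]
        constructor <;> nlinarith [sq_nonneg (w t y)]
      have h5 : H t y ^ 2 ≤ (N + W ^ 2 / 2) ^ 2 := sq_le_sq' (abs_le.1 h4).1 (abs_le.1 h4).2
      have h6 : 0 ≤ W ^ 2 + (N + W ^ 2 / 2) ^ 2 := by positivity
      nlinarith
    · intro y hy
      simp [hH, hw0 y hy, hΘ0 y hy]
    · intro t ht
      simp [hH, hww t ht, hΘw t ht]
    · intro t ht y hy
      have h1 := hwt t ht y hy
      have h2 := (hΘt t ht y hy).add ((h1.pow 2).div_const 2)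
      refine ((h1.pow 2).add (h2.pow 2)).congr_deriv ?_
      simp only [hH, Pi.add_apply, Pi.pow_apply, Nat.cast_ofNat, Nat.add_one_sub_one, pow_one]
      ring
    · intro t ht y hy
      have h1 := hwy t ht y hy
      have h2 := (hΘy t ht y hy).add ((h1.pow 2).div_const 2)
      refine ((h1.pow 2).add (h2.pow 2)).congr_deriv ?_
      simp only [hH, Pi.add_apply, Pi.pow_apply, Nat.cast_ofNat, Nat.add_one_sub_one, pow_one]
      ring
    · intro t ht y hy
      have h1 := hwy t ht y hy
      have h2 := hΘy t ht y hy
      have h3 := hwyy t ht y hy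
      have h4 := h2.add ((h1.pow 2).div_const 2)
      have h5 := (hΘyy t ht y hy).add (h1.mul h3)
      refine (((h1.const_mul 2).mul h3).add ((h4.const_mul 2).mul h5)).congr_deriv ?_
      simp [hH]
      ring
    · intro t ht y hy _
      have e1 := hweq t ht y hy
      have e2 := hΘeq t ht y hy
      have hΘe : Θ t y = H t y - w t y ^ 2 / 2 := by simp [hH]
      have h1 := abs_le.1 (hW t ⟨ht.1.le, ht.2⟩ y hy.le)
      have h3 := abs_le.1 (ha t ht y hy)
      have h4 : |η t y + w t y * a t y + Θ t y| ≤ 2 * N + W * M := by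
        have h5 : |w t y * a t y| ≤ W * M := by
          rw [abs_mul]
          exact mul_le_mul (hW t ⟨ht.1.le, ht.2⟩ y hy.le) (ha t ht y hy) (abs_nonneg _) hW0
        calc _ ≤ |η t y| + |w t y * a t y| + |Θ t y| := abs_add_three _ _ _
          _ ≤ N + W * M + N := add_le_add_three (hη t ht y hy) h5 (hΘ t ht y hy)
          _ = _ := by ring
      -- the gradient term `wy ^ 2` of the heat equation cancels in the equation of the energy `H`
      have key : 2 * w t y * wt t y + 2 * H t y * (Θt t y + w t y * wt t y) +
          v t y * (2 * w t y * wy t y + 2 * H t y * (Θy t y + w t y * wy t y)) -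
          (2 * (wy t y * wy t y + w t y * wyy t y) +
          2 * ((Θy t y + w t y * wy t y) * (Θy t y + w t y * wy t y) +
          H t y * (Θyy t y + (wy t y * wy t y + w t y * wyy t y)))) =
          2 * w t y ^ 2 * (-a t y) - 2 * (w t y * H t y) + w t y ^ 2 * w t y
            + 2 * (H t y * w t y) * -(η t y + w t y * a t y + Θ t y)
            - 2 * wy t y ^ 2 - 2 * (Θy t y + w t y * wy t y) ^ 2 := by
        linear_combination (2 * w t y + 2 * H t y * w t y) * e1 + 2 * H t y * e2 -
          2 * w t y * hΘe
      rw [key]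
      generalize η t y + w t y * a t y + Θ t y = c at *
      have k1 : 2 * w t y ^ 2 * (-a t y) ≤ 2 * w t y ^ 2 * M :=
        mul_le_mul_of_nonneg_left (by linarith) (by positivity)
      have k2 : w t y ^ 2 * w t y ≤ w t y ^ 2 * W :=
        mul_le_mul_of_nonneg_left (by linarith) (by positivity)
      have k3 : 2 * (H t y * w t y) * -c ≤ (w t y ^ 2 + H t y ^ 2) * (2 * N + W * M) := by
        calc 2 * (H t y * w t y) * -c ≤ |2 * (H t y * w t y) * -c| := le_abs_self _
          _ = |2 * (H t y * w t y)| * |c| := by rw [abs_mul, abs_neg]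
          _ ≤ (w t y ^ 2 + H t y ^ 2) * (2 * N + W * M) := by
            refine mul_le_mul ?_ h4 (abs_nonneg _) (by positivity)
            rw [abs_le]
            constructor <;> nlinarith [sq_nonneg (w t y - H t y), sq_nonneg (w t y + H t y)]
      have k4 : 0 ≤ (w t y + H t y) ^ 2 := sq_nonneg _
      have k5 : 0 ≤ H t y ^ 2 * W := by positivity
      have k6 : 0 ≤ H t y ^ 2 * M := by positivity
      have k7 := sq_nonneg (wy t y)
      have k8 := sq_nonneg (Θy t y + w t y * wy t y)
      generalize (Θy t y + w t y * wy t y) ^ 2 = r at *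
      linarith
  have h1 : w t y = 0 := by nlinarith [sq_nonneg (w t y), sq_nonneg (H t y)]
  have h2 : H t y = 0 := by nlinarith [sq_nonneg (w t y), sq_nonneg (H t y)]
  refine ⟨h1, ?_⟩
  simpa [hH, h1] using h2

end AxisSystem

/-! ### The weight and the functional -/

/-- The weight `𝒴(y) = y / (1 + y²)²`. It vanishes at the wall, where `∂_y b` is not controlled, and
its second derivative is dominated by `𝒴` itself both at the wall and at infinity. -/
noncomputable def layerWeight (y : ℝ) : ℝ := y / (1 + y ^ 2) ^ 2

theorem continuous_layerWeight : Continuous layerWeight := by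
  unfold layerWeight
  exact continuous_id.div (by fun_prop) fun y => by positivity

theorem layerWeight_pos {y : ℝ} (hy : 0 < y) : 0 < layerWeight y := by
  unfold layerWeight; positivity

theorem layerWeight_nonneg {y : ℝ} (hy : 0 ≤ y) : 0 ≤ layerWeight y := by
  unfold layerWeight; positivity

theorem hasDerivAt_layerWeight (y : ℝ) :
    HasDerivAt layerWeight ((1 - 3 * y ^ 2) / (1 + y ^ 2) ^ 3) y := by
  have h0 : (1 + y ^ 2 : ℝ) ≠ 0 := by positivity
  have h1 : HasDerivAt (fun z : ℝ => (1 + z ^ 2) ^ 2) (2 * (1 + y ^ 2) * (2 * y)) y := by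
    refine ((((hasDerivAt_id y).pow 2).const_add 1).pow 2).congr_deriv ?_
    simp
  refine ((hasDerivAt_id y).div h1 (by positivity)).congr_deriv ?_
  simp only [id]
  field_simp
  ring

theorem hasDerivAt_layerWeight_deriv (y : ℝ) :
    HasDerivAt (fun z : ℝ => (1 - 3 * z ^ 2) / (1 + z ^ 2) ^ 3)
      (12 * (y ^ 3 - y) / (1 + y ^ 2) ^ 4) y := by
  have h0 : (1 + y ^ 2 : ℝ) ≠ 0 := by positivity
  have h1 : HasDerivAt (fun z : ℝ => (1 + z ^ 2) ^ 3) (3 * (1 + y ^ 2) ^ 2 * (2 * y)) y := by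
    refine ((((hasDerivAt_id y).pow 2).const_add 1).pow 3).congr_deriv ?_
    simp
  have h2 : HasDerivAt (fun z : ℝ => 1 - 3 * z ^ 2) (-(3 * (2 * y))) y := by
    refine ((((hasDerivAt_id y).pow 2).const_mul 3).const_sub 1).congr_deriv ?_
    simp
  refine (h2.div h1 (by positivity)).congr_deriv ?_
  field_simp
  ring

/-- The coefficient `g` of the total derivative `(g v²)'` in the weighted Hardy inequality for the
weight `layerWeight`. It increases from `-1/2` to `0`. -/
noncomputable def hardyCoeff (y : ℝ) : ℝ := -(1 + 3 * y ^ 2) / (2 * (1 + y ^ 2) ^ 3)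

theorem hasDerivAt_hardyCoeff (y : ℝ) :
    HasDerivAt hardyCoeff (6 * y ^ 3 / (1 + y ^ 2) ^ 4) y := by
  have h0 : (1 + y ^ 2 : ℝ) ≠ 0 := by positivity
  have h1 : HasDerivAt (fun z : ℝ => 2 * (1 + z ^ 2) ^ 3)
      (2 * (3 * (1 + y ^ 2) ^ 2 * (2 * y))) y := by
    refine (((((hasDerivAt_id y).pow 2).const_add 1).pow 3).const_mul 2).congr_deriv ?_
    simp
  have h2 : HasDerivAt (fun z : ℝ => -(1 + 3 * z ^ 2)) (-(3 * (2 * y))) y := by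
    refine ((((hasDerivAt_id y).pow 2).const_mul 3).const_add 1).neg.congr_deriv ?_
    simp
  refine (h2.div h1 (by positivity)).congr_deriv ?_
  field_simp
  ring

theorem hardyCoeff_nonpos (y : ℝ) : hardyCoeff y ≤ 0 := by
  unfold hardyCoeff
  exact div_nonpos_of_nonpos_of_nonneg (by nlinarith [sq_nonneg y]) (by positivity)

/-- With `b = v'`, the left side is `2 b² 𝒴 + v b 𝒴' + (g v²)'`. That it is at least `b² 𝒴 / 2` is
the Hardy-type inequality which lets the quadratic source win over the transport term. -/
theorem hardy_identity (y b v : ℝ) :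
    2 * b ^ 2 * layerWeight y + v * b * ((1 - 3 * y ^ 2) / (1 + y ^ 2) ^ 3) +
        6 * y ^ 3 / (1 + y ^ 2) ^ 4 * v ^ 2 + 2 * hardyCoeff y * v * b =
      b ^ 2 / 2 * layerWeight y + 3 / 2 * layerWeight y * (b - 2 * y * v / (1 + y ^ 2)) ^ 2 := by
  have h0 : (1 + y ^ 2 : ℝ) ≠ 0 := by positivity
  unfold layerWeight hardyCoeff
  field_simp
  ring

theorem abs_layerWeight_second_deriv_le {y : ℝ} (hy : 0 ≤ y) :
    |12 * (y ^ 3 - y) / (1 + y ^ 2) ^ 4| ≤ 12 * layerWeight y := by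
  have h1 : 12 * (y ^ 3 - y) / (1 + y ^ 2) ^ 4
      = 12 * layerWeight y * ((y ^ 2 - 1) / (1 + y ^ 2) ^ 2) := by
    unfold layerWeight
    field_simp
  have h2 : |(y ^ 2 - 1) / (1 + y ^ 2) ^ 2| ≤ 1 := by
    rw [abs_div, abs_of_pos (by positivity : 0 < (1 + y ^ 2) ^ 2), div_le_one (by positivity),
      abs_le]
    constructor <;> nlinarith [sq_nonneg y, sq_nonneg (y ^ 2)]
  have h3 := layerWeight_nonneg hy
  rw [h1, abs_mul, abs_of_nonneg (by positivity)]
  exact mul_le_of_le_one_right (by positivity) h2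

theorem hasDerivAt_layerWeight_primitive (y : ℝ) :
    HasDerivAt (fun z : ℝ => -(1 / (2 * (1 + z ^ 2)))) (layerWeight y) y := by
  have h0 : (1 + y ^ 2 : ℝ) ≠ 0 := by positivity
  have h1 : HasDerivAt (fun z : ℝ => 2 * (1 + z ^ 2)) (2 * (2 * y)) y := by
    refine ((((hasDerivAt_id y).pow 2).const_add 1).const_mul 2).congr_deriv ?_
    simp
  refine ((hasDerivAt_const y (1 : ℝ)).div h1 (by positivity)).neg.congr_deriv ?_
  unfold layerWeight
  field_simp
  ring

theorem integrableOn_layerWeight : IntegrableOn layerWeight (Ioi 0) := by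
  refine integrableOn_Ioi_deriv_of_nonneg' (g := fun z : ℝ => -(1 / (2 * (1 + z ^ 2)))) (l := 0)
    (fun y _ => hasDerivAt_layerWeight_primitive y)
    (fun y hy => layerWeight_nonneg (le_of_lt hy)) ?_
  have h1 : Tendsto (fun z : ℝ => 2 * (1 + z ^ 2)) atTop atTop :=
    (tendsto_atTop_add_const_left _ _ (tendsto_pow_atTop two_ne_zero)).const_mul_atTop two_pos
  simpa using h1.inv_tendsto_atTop.neg

theorem integral_layerWeight_le (R : ℝ) : ∫ y in (0 : ℝ)..R, layerWeight y ≤ 1 / 2 := by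
  rw [intervalIntegral.integral_eq_sub_of_hasDerivAt
    (fun y _ => hasDerivAt_layerWeight_primitive y)
    (continuous_layerWeight.intervalIntegrable _ _)]
  have : 0 ≤ 1 / (2 * (1 + R ^ 2)) := by positivity
  norm_num
  norm_num at this
  exact this

theorem hasDerivAt_intervalIntegral_of_continuousOn {f f' : ℝ → ℝ → ℝ} {a c d e t : ℝ}
    (hde : d ≤ e) (ht : t ∈ Ioo a c) (hf : ∀ s ∈ Ioo a c, ContinuousOn (f s) (Icc d e))
    (hf' : ContinuousOn (fun p : ℝ × ℝ => f' p.1 p.2) (Ioo a c ×ˢ Icc d e))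
    (hd : ∀ s ∈ Ioo a c, ∀ z ∈ Icc d e, HasDerivAt (fun s => f s z) (f' s z) s) :
    HasDerivAt (fun s => ∫ z in d..e, f s z) (∫ z in d..e, f' t z) t := by
  obtain ⟨a', ha, hat⟩ := exists_between ht.1
  obtain ⟨c', htc, hc⟩ := exists_between ht.2
  have hsub : Icc a' c' ⊆ Ioo a c := fun s hs => ⟨ha.trans_le hs.1, hs.2.trans_lt hc⟩
  obtain ⟨C, hC⟩ := (isCompact_Icc.prod isCompact_Icc).exists_bound_of_continuousOn
    (hf'.mono (prod_mono_left hsub : Icc a' c' ×ˢ Icc d e ⊆ _))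
  have hI : uIoc d e ⊆ Icc d e := by
    rw [uIoc_of_le hde]
    exact Ioc_subset_Icc_self
  have hf't : ContinuousOn (f' t) (Icc d e) :=
    hf'.comp (f := fun z : ℝ => (t, z)) (by fun_prop) fun z hz => ⟨ht, hz⟩
  refine (intervalIntegral.hasDerivAt_integral_of_dominated_loc_of_deriv_le (s := Icc a' c')
    (F := f) (F' := f') (bound := fun _ => C) (Icc_mem_nhds hat htc) ?_ ?_ ?_ ?_ ?_ ?_).2
  · filter_upwards [Ioo_mem_nhds ht.1 ht.2] with s hs
    exact ((hf s hs).mono hI).aestronglyMeasurable measurableSet_uIoc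
  · exact (hf t ht).intervalIntegrable_of_Icc hde
  · exact (hf't.mono hI).aestronglyMeasurable measurableSet_uIoc
  · exact Eventually.of_forall fun z hz s hs => hC (s, z) ⟨hs, hI hz⟩
  · exact intervalIntegrable_const
  · exact Eventually.of_forall fun z hz s hs => hd s (hsub hs) z (hI hz)

/-- The weight on `[0, R]`: `layerWeight` minus the small multiple of `z` that makes it vanish at
`R` as well as at `0`, so that integrating `∂_y² b` against it leaves no derivative of `b` at the
ends. -/
noncomputable def truncatedWeight (R z : ℝ) : ℝ := layerWeight z - z / (1 + R ^ 2) ^ 2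

section Functional

variable {R z : ℝ}

theorem continuous_truncatedWeight : Continuous (truncatedWeight R) :=
  continuous_layerWeight.sub (continuous_id.div_const _)

@[simp] theorem truncatedWeight_zero : truncatedWeight R 0 = 0 := by
  simp [truncatedWeight, layerWeight]

@[simp] theorem truncatedWeight_self : truncatedWeight R R = 0 := by
  simp [truncatedWeight, layerWeight]

theorem truncatedWeight_nonneg (hz : z ∈ Icc 0 R) : 0 ≤ truncatedWeight R z := by
  unfold truncatedWeight layerWeight
  rw [sub_nonneg]
  have h0 := hz.1
  have h1 : z ^ 2 ≤ R ^ 2 := pow_le_pow_left₀ h0 hz.2 2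
  gcongr

theorem truncatedWeight_le (hz : 0 ≤ z) : truncatedWeight R z ≤ layerWeight z := by
  unfold truncatedWeight
  have : 0 ≤ z / (1 + R ^ 2) ^ 2 := by positivity
  linarith

theorem hasDerivAt_truncatedWeight :
    HasDerivAt (truncatedWeight R) ((1 - 3 * z ^ 2) / (1 + z ^ 2) ^ 3 - 1 / (1 + R ^ 2) ^ 2) z :=
  (hasDerivAt_layerWeight z).sub ((hasDerivAt_id z).div_const _)

/-- Pointwise lower bound for what is left of the density of the functional once a total derivative
is removed. -/
theorem truncated_density_ge {M CP ε b v : ℝ} (F : ℝ) (hM : 0 ≤ M) (hCP : 0 ≤ CP) (hR : 1 ≤ R)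
    (hε : 0 < ε) (hε1 : ε ≤ 1) (hz : z ∈ Icc 0 R) (hb : |b| ≤ M) (hv : |v| ≤ M * (ε + z)) :
    F * (b * truncatedWeight R z) - (F ^ 2 + 144 + CP) * layerWeight z -
        4 * M ^ 2 * (1 / (1 + R ^ 2) ^ 2) * R ≤
      b * (12 * (z ^ 3 - z) / (1 + z ^ 2) ^ 4) + 2 * b ^ 2 * truncatedWeight R z +
        v * b * ((1 - 3 * z ^ 2) / (1 + z ^ 2) ^ 3 - 1 / (1 + R ^ 2) ^ 2) +
        6 * z ^ 3 / (1 + z ^ 2) ^ 4 * v ^ 2 + 2 * hardyCoeff z * v * b -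
        CP * truncatedWeight R z := by
  have h2 := hardy_identity z b v
  have hψ0 : 0 ≤ truncatedWeight R z := truncatedWeight_nonneg hz
  have hψY : truncatedWeight R z ≤ layerWeight z := truncatedWeight_le hz.1
  have hY : 0 ≤ layerWeight z := layerWeight_nonneg hz.1
  have hsq : 0 ≤ 3 / 2 * layerWeight z * (b - 2 * z * v / (1 + z ^ 2)) ^ 2 := by positivity
  have h3 : -(|b| * (12 * layerWeight z)) ≤ b * (12 * (z ^ 3 - z) / (1 + z ^ 2) ^ 4) := by
    refine neg_le_of_abs_le ?_
    rw [abs_mul]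
    exact mul_le_mul_of_nonneg_left (abs_layerWeight_second_deriv_le hz.1) (abs_nonneg _)
  have hψe : truncatedWeight R z = layerWeight z - 1 / (1 + R ^ 2) ^ 2 * z := by
    simp only [truncatedWeight]; ring
  have hκ0 : 0 ≤ 1 / (1 + R ^ 2) ^ 2 := by positivity
  generalize 1 / (1 + R ^ 2) ^ 2 = κ at *
  generalize 12 * (z ^ 3 - z) / (1 + z ^ 2) ^ 4 = ψ'' at *
  generalize (1 - 3 * z ^ 2) / (1 + z ^ 2) ^ 3 = Y' at *
  generalize 6 * z ^ 3 / (1 + z ^ 2) ^ 4 = g' at *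
  generalize (b - 2 * z * v / (1 + z ^ 2)) ^ 2 = r at *
  generalize truncatedWeight R z = ψ at *
  generalize layerWeight z = Y at *
  have h4 : κ * (2 * b ^ 2 * z + v * b) ≤ 4 * M ^ 2 * κ * R := by
    have k1 : b ^ 2 ≤ M ^ 2 := sq_le_sq' (abs_le.1 hb).1 (abs_le.1 hb).2
    have k2 : v * b ≤ M * (ε + z) * M := by
      refine (le_abs_self _).trans ?_
      rw [abs_mul]
      exact mul_le_mul hv hb (abs_nonneg _) (mul_nonneg hM (by linarith [hz.1]))
    have k3 : b ^ 2 * z ≤ M ^ 2 * R := mul_le_mul k1 hz.2 hz.1 (sq_nonneg _)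
    have k4 : M ^ 2 * (ε + z) ≤ M ^ 2 * (R + R) :=
      mul_le_mul_of_nonneg_left (by linarith [hz.2]) (sq_nonneg _)
    have k5 : 2 * b ^ 2 * z + v * b ≤ 4 * M ^ 2 * R := by linarith
    calc _ ≤ κ * (4 * M ^ 2 * R) := mul_le_mul_of_nonneg_left k5 hκ0
      _ = _ := by ring
  have h5 : (|b| * 12 - b ^ 2 / 4 - 144) * Y ≤ 0 := by
    refine mul_nonpos_of_nonpos_of_nonneg ?_ hY
    linarith [sq_nonneg (|b| - 24), sq_abs b]
  -- the tangent line bound `b ^ 2 ≥ 4 F b - 4 F ^ 2` replaces the Cauchy-Schwarz inequality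
  have h6 : F * (b * ψ) - F ^ 2 * Y ≤ b ^ 2 / 4 * Y := by
    have k1 : 0 ≤ (b - 2 * F) ^ 2 * ψ := mul_nonneg (sq_nonneg _) hψ0
    have k2 : 0 ≤ (b ^ 2 / 4 + F ^ 2) * (Y - ψ) := mul_nonneg (by positivity) (by linarith)
    linarith
  have h7 : CP * ψ ≤ CP * Y := mul_le_mul_of_nonneg_left hψY hCP
  have h8 : 2 * b ^ 2 * ψ = 2 * b ^ 2 * Y - κ * (2 * b ^ 2 * z) := by rw [hψe]; ring
  linarith

/-- Lower bound, at a fixed time, for the time derivative of `F = ∫ b(ε + z) ψ(z) dz`, where `ψ` is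
the truncated weight. The integration starts at height `ε`, since `b` is only continuous at the wall;
the boundary terms at `z = 0` and `z = R` are small as `ε → 0` and `R → ∞`. -/
theorem truncated_functional_deriv_ge {M CP ε F : ℝ} {b bt b_y byy v : ℝ → ℝ}
    (hM : 0 ≤ M) (hCP : 0 ≤ CP) (hR : 1 ≤ R) (hε : 0 < ε) (hε1 : ε ≤ 1)
    (hbM : ∀ y, 0 < y → |b y| ≤ M) (hvM : ∀ y, 0 < y → |v y| ≤ M * y)
    (hv : ∀ y, 0 < y → HasDerivAt v (b y) y)
    (hb : ∀ y, 0 < y → HasDerivAt b (b_y y) y)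
    (hby : ∀ y, 0 < y → HasDerivAt b_y (byy y) y)
    (hbyy : ContinuousOn byy (Ioi 0)) (hbt : ContinuousOn bt (Ioi 0))
    (heq : ∀ y, 0 < y → byy y - v y * b_y y + b y ^ 2 - CP ≤ bt y)
    (hF : F = ∫ z in (0 : ℝ)..R, b (ε + z) * truncatedWeight R z) :
    F ^ 2 / 2 - (72 + CP / 2) - |b ε| - M ^ 2 * ε ^ 2 / 2 - (4 * M + 4 * M ^ 2) / R ≤
      ∫ z in (0 : ℝ)..R, bt (ε + z) * truncatedWeight R z := by
  have hR0 : 0 ≤ R := by linarith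
  set κ : ℝ := 1 / (1 + R ^ 2) ^ 2 with hκ
  have hκ0 : 0 ≤ κ := by positivity
  set ψ := truncatedWeight R with hψ
  set ψ' : ℝ → ℝ := fun z => (1 - 3 * z ^ 2) / (1 + z ^ 2) ^ 3 - κ with hψ'
  set ψ'' : ℝ → ℝ := fun z => 12 * (z ^ 3 - z) / (1 + z ^ 2) ^ 4 with hψ''
  set g' : ℝ → ℝ := fun z => 6 * z ^ 3 / (1 + z ^ 2) ^ 4 with hg'
  have hψd : ∀ z, HasDerivAt ψ (ψ' z) z := fun z => hasDerivAt_truncatedWeight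
  have hψd' : ∀ z, HasDerivAt ψ' (ψ'' z) z := fun z => (hasDerivAt_layerWeight_deriv z).sub_const _
  have hpos : ∀ z ∈ Icc (0 : ℝ) R, 0 < ε + z := fun z hz => by linarith [hz.1]
  have hshift : ∀ {h : ℝ → ℝ} {h' z : ℝ}, HasDerivAt h h' (ε + z) →
      HasDerivAt (fun z => h (ε + z)) h' z := fun {h h' z} hd => by
    simpa using hd.comp_const_add ε z
  have hmaps : MapsTo (fun z : ℝ => ε + z) (Icc 0 R) (Ioi 0) := fun z hz => hpos z hz
  have hadd : ContinuousOn (fun z : ℝ => ε + z) (Icc 0 R) := by fun_prop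
  have cb : ContinuousOn (fun z => b (ε + z)) (Icc 0 R) := fun z hz =>
    (hshift (hb _ (hpos z hz))).continuousAt.continuousWithinAt
  have cby : ContinuousOn (fun z => b_y (ε + z)) (Icc 0 R) := fun z hz =>
    (hshift (hby _ (hpos z hz))).continuousAt.continuousWithinAt
  have cv : ContinuousOn (fun z => v (ε + z)) (Icc 0 R) := fun z hz =>
    (hshift (hv _ (hpos z hz))).continuousAt.continuousWithinAt
  have cbyy : ContinuousOn (fun z => byy (ε + z)) (Icc 0 R) := hbyy.comp hadd hmaps
  have cbt : ContinuousOn (fun z => bt (ε + z)) (Icc 0 R) := hbt.comp hadd hmaps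
  have cψ : ContinuousOn ψ (Icc 0 R) := continuous_truncatedWeight.continuousOn
  have cψ' : ContinuousOn ψ' (Icc 0 R) := fun z _ => (hψd' z).continuousAt.continuousWithinAt
  have cψ'' : ContinuousOn ψ'' (Icc 0 R) := by
    refine ContinuousOn.div (by fun_prop) (by fun_prop) fun z _ => by positivity
  have cg' : ContinuousOn g' (Icc 0 R) := by
    refine ContinuousOn.div (by fun_prop) (by fun_prop) fun z _ => by positivity
  have cg : ContinuousOn hardyCoeff (Icc 0 R) := fun z _ =>
    (hasDerivAt_hardyCoeff z).continuousAt.continuousWithinAt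
  -- the flux, whose increment collects all boundary terms of the integrations by parts
  set J : ℝ → ℝ := fun z => b_y (ε + z) * ψ z - b (ε + z) * ψ' z - v (ε + z) * b (ε + z) * ψ z -
    hardyCoeff z * v (ε + z) ^ 2 with hJ
  set J' : ℝ → ℝ := fun z => byy (ε + z) * ψ z - b (ε + z) * ψ'' z - b (ε + z) ^ 2 * ψ z -
    v (ε + z) * b_y (ε + z) * ψ z - v (ε + z) * b (ε + z) * ψ' z - g' z * v (ε + z) ^ 2 -
    2 * hardyCoeff z * v (ε + z) * b (ε + z) with hJ'
  have hJd : ∀ z ∈ Icc (0 : ℝ) R, HasDerivAt J (J' z) z := by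
    intro z hz
    have d1 := hshift (hb _ (hpos z hz))
    have d2 := hshift (hby _ (hpos z hz))
    have d3 := hshift (hv _ (hpos z hz))
    refine ((((d2.mul (hψd z)).sub (d1.mul (hψd' z))).sub ((d3.mul d1).mul (hψd z))).sub
      ((hasDerivAt_hardyCoeff z).mul (d3.pow 2))).congr_deriv ?_
    simp only [hJ', hg', Pi.mul_apply, Pi.pow_apply, Nat.cast_ofNat, Nat.add_one_sub_one, pow_one]
    ring
  have cJ' : ContinuousOn J' (Icc 0 R) := by
    exact ((((((cbyy.mul cψ).sub (cb.mul cψ'')).sub ((cb.pow 2).mul cψ)).sub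
      ((cv.mul cby).mul cψ)).sub ((cv.mul cb).mul cψ')).sub (cg'.mul (cv.pow 2))).sub
      (((continuousOn_const.mul cg).mul cv).mul cb)
  have hFTC : ∫ z in (0 : ℝ)..R, J' z = J R - J 0 := by
    refine intervalIntegral.integral_eq_sub_of_hasDerivAt (fun z hz => hJd z ?_)
      (cJ'.intervalIntegrable_of_Icc hR0)
    rwa [uIcc_of_le hR0] at hz
  have hpt : ∀ z ∈ Icc (0 : ℝ) R,
      J' z + F * (b (ε + z) * ψ z) - (F ^ 2 + 144 + CP) * layerWeight z - 4 * M ^ 2 * κ * R ≤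
        bt (ε + z) * ψ z := by
    intro z hz
    have h1 := mul_le_mul_of_nonneg_right (heq _ (hpos z hz)) (truncatedWeight_nonneg hz)
    have h2 := truncated_density_ge F hM hCP hR hε hε1 hz (hbM _ (hpos z hz)) (hvM _ (hpos z hz))
    refine le_trans ?_ h1
    simp only [hJ', hψ', hψ'', hg']
    linarith
  have hmono := intervalIntegral.integral_mono_on (μ := volume) hR0
    (ContinuousOn.intervalIntegrable_of_Icc hR0 (by
      refine ((cJ'.add (continuousOn_const.mul (cb.mul cψ))).sub
        (continuousOn_const.mul continuous_layerWeight.continuousOn)).sub continuousOn_const))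
    ((cbt.mul cψ).intervalIntegrable_of_Icc hR0) hpt
  refine le_trans ?_ hmono
  have i1 : IntervalIntegrable J' volume 0 R := cJ'.intervalIntegrable_of_Icc hR0
  have i2 : IntervalIntegrable (fun z => F * (b (ε + z) * ψ z)) volume 0 R :=
    (continuousOn_const.mul (cb.mul cψ)).intervalIntegrable_of_Icc hR0
  have i3 : IntervalIntegrable (fun z => (F ^ 2 + 144 + CP) * layerWeight z) volume 0 R :=
    (continuous_const.mul continuous_layerWeight).intervalIntegrable _ _
  rw [intervalIntegral.integral_sub ((i1.add i2).sub i3) intervalIntegrable_const,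
    intervalIntegral.integral_sub (i1.add i2) i3, intervalIntegral.integral_add i1 i2,
    intervalIntegral.integral_const_mul, intervalIntegral.integral_const_mul, ← hF, hFTC,
    intervalIntegral.integral_const, sub_zero, smul_eq_mul]
  have e1 : (F ^ 2 + 144 + CP) * ∫ y in (0 : ℝ)..R, layerWeight y ≤ (F ^ 2 + 144 + CP) * (1 / 2) :=
    mul_le_mul_of_nonneg_left (integral_layerWeight_le R) (by positivity)
  have hεR : 0 < ε + R := by linarith
  have e2 : -(M * (4 / R)) ≤ J R := by
    have k1 : J R = b (ε + R) * (4 * R ^ 2 / (1 + R ^ 2) ^ 3) - hardyCoeff R * v (ε + R) ^ 2 := by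
      simp only [hJ, hψ, truncatedWeight_self, hψ', hκ]
      field_simp
      ring
    have k2 : 0 ≤ -hardyCoeff R * v (ε + R) ^ 2 :=
      mul_nonneg (by linarith [hardyCoeff_nonpos R]) (sq_nonneg _)
    have k3 : 4 * R ^ 2 / (1 + R ^ 2) ^ 3 ≤ 4 / R := by
      rw [div_le_div_iff₀ (by positivity) (by linarith)]
      have : R ^ 3 ≤ (1 + R ^ 2) ^ 3 := pow_le_pow_left₀ hR0 (by nlinarith) 3
      linarith
    have k4 : -(M * (4 / R)) ≤ b (ε + R) * (4 * R ^ 2 / (1 + R ^ 2) ^ 3) := by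
      refine neg_le_of_abs_le ?_
      rw [abs_mul, abs_of_nonneg (by positivity : 0 ≤ 4 * R ^ 2 / (1 + R ^ 2) ^ 3)]
      exact mul_le_mul (hbM _ hεR) k3 (by positivity) hM
    rw [k1]
    linarith
  have e3 : J 0 ≤ |b ε| + M ^ 2 * ε ^ 2 / 2 := by
    have k1 : J 0 = -(b ε * (1 - κ)) + v ε ^ 2 / 2 := by
      simp only [hJ, hψ, truncatedWeight_zero, hψ', hardyCoeff]
      norm_num
      ring
    have k2 : κ ≤ 1 := by
      rw [hκ, div_le_one (by positivity)]
      exact one_le_pow₀ (by nlinarith)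
    have k3 : -(b ε * (1 - κ)) ≤ |b ε| := by
      refine (neg_le_abs _).trans ?_
      rw [abs_mul]
      exact mul_le_of_le_one_right (abs_nonneg _) (abs_le.2 ⟨by linarith, by linarith⟩)
    have k4 : v ε ^ 2 ≤ (M * ε) ^ 2 :=
      sq_le_sq' (abs_le.1 (hvM ε hε)).1 (abs_le.1 (hvM ε hε)).2
    rw [k1]
    rw [mul_pow] at k4
    linarith
  have e4 : R * (4 * M ^ 2 * κ * R) ≤ 4 * M ^ 2 * (1 / R) := by
    have : κ * R ^ 2 ≤ 1 / R := by
      rw [hκ, one_div_mul_eq_div, div_le_div_iff₀ (by positivity) (by linarith)]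
      have : R ^ 2 * R ≤ (1 + R ^ 2) * (1 + R ^ 2) :=
        mul_le_mul (by linarith) (by nlinarith) hR0 (by positivity)
      linarith
    calc _ = 4 * M ^ 2 * (κ * R ^ 2) := by ring
      _ ≤ _ := mul_le_mul_of_nonneg_left this (by positivity)
  have e5 : (4 * M + 4 * M ^ 2) / R = M * (4 / R) + 4 * M ^ 2 * (1 / R) := by ring
  rw [e5]
  linarith

end Functional

/-! ### The differential inequality for the slope on the axis -/

/-- A bounded solution of `∂ₜb ≥ ∂_y²b - v ∂_y b + b² - CP`, with `b = ∂_y v` and `b = 0` at the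
wall, that lives up to time `τ` has small initial mass against the weight. -/
theorem axis_slope_mass_lt {τ M CP : ℝ} {b bt b_y byy v : ℝ → ℝ → ℝ} (hτ : 0 < τ) (hM : 0 ≤ M)
    (hCP : 0 ≤ CP)
    (hbc : ContinuousOn (fun p : ℝ × ℝ => b p.1 p.2) (Icc 0 τ ×ˢ Ici 0))
    (hb0 : ∀ t ∈ Icc 0 τ, b t 0 = 0)
    (hbM : ∀ t ∈ Ico 0 τ, ∀ y, 0 < y → |b t y| ≤ M)
    (hvM : ∀ t ∈ Ioo 0 τ, ∀ y, 0 < y → |v t y| ≤ M * y)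
    (hv : ∀ t ∈ Ioo 0 τ, ∀ y, 0 < y → HasDerivAt (v t) (b t y) y)
    (hbt : ∀ t ∈ Ioo 0 τ, ∀ y, 0 < y → HasDerivAt (fun s => b s y) (bt t y) t)
    (hby : ∀ t ∈ Ioo 0 τ, ∀ y, 0 < y → HasDerivAt (b t) (b_y t y) y)
    (hbyy : ∀ t ∈ Ioo 0 τ, ∀ y, 0 < y → HasDerivAt (b_y t) (byy t y) y)
    (hbtc : ContinuousOn (fun p : ℝ × ℝ => bt p.1 p.2) (Ioo 0 τ ×ˢ Ioi 0))
    (hbyyc : ∀ t ∈ Ioo 0 τ, ContinuousOn (byy t) (Ioi 0))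
    (heq : ∀ t ∈ Ioo 0 τ, ∀ y, 0 < y →
      byy t y - v t y * b_y t y + b t y ^ 2 - CP ≤ bt t y) :
    ∫ y in Ioi 0, b 0 y * layerWeight y < 8 / τ + 4 * (73 + CP / 2) + 3 := by
  by_contra! hK
  have h0τ : (0 : ℝ) ∈ Icc 0 τ := ⟨le_rfl, hτ.le⟩
  have h0τ' : (0 : ℝ) ∈ Ico 0 τ := ⟨le_rfl, hτ⟩
  have hb0c : ContinuousOn (b 0) (Ici 0) :=
    hbc.comp (f := fun y : ℝ => ((0 : ℝ), y)) (by fun_prop) fun y hy => ⟨h0τ, hy⟩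
  have hb0int : IntegrableOn (fun y => b 0 y * layerWeight y) (Ioi 0) := by
    refine Integrable.bdd_mul (c := M) integrableOn_layerWeight
      ((hb0c.mono Ioi_subset_Ici_self).aestronglyMeasurable measurableSet_Ioi) ?_
    filter_upwards [ae_restrict_mem measurableSet_Ioi] with y hy using hbM 0 h0τ' y hy
  -- the height of the truncation
  obtain ⟨R, hR1, hRM, hRint⟩ : ∃ R : ℝ, 1 ≤ R ∧ 8 * M + 8 * M ^ 2 ≤ R ∧
      (∫ y in Ioi 0, b 0 y * layerWeight y) - 1 / 4 < ∫ y in (0 : ℝ)..R, b 0 y * layerWeight y := by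
    have h1 := intervalIntegral_tendsto_integral_Ioi 0 hb0int tendsto_id
    exact ((eventually_ge_atTop 1).and ((eventually_ge_atTop (8 * M + 8 * M ^ 2)).and
      (h1.eventually (lt_mem_nhds (by linarith))))).exists
  have hR0 : 0 ≤ R := by linarith
  -- the truncation of the weight costs little
  have hRint' : (∫ y in Ioi 0, b 0 y * layerWeight y) - 1 / 2 <
      ∫ z in (0 : ℝ)..R, b 0 z * truncatedWeight R z := by
    have c1 : ContinuousOn (b 0) (Icc 0 R) := hb0c.mono Icc_subset_Ici_self
    have h1 : ∀ z ∈ Icc 0 R, b 0 z * layerWeight z - M * (1 / R ^ 3) ≤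
        b 0 z * truncatedWeight R z := by
      intro z hz
      have h2 : b 0 z ≤ M := by
        rcases hz.1.eq_or_lt with h | h
        · rw [← h, hb0 0 h0τ]
          exact hM
        · exact (abs_le.1 (hbM 0 h0τ' z h)).2
      have h3 : z / (1 + R ^ 2) ^ 2 ≤ 1 / R ^ 3 := by
        rw [div_le_div_iff₀ (by positivity) (by positivity)]
        have : z * R ^ 3 ≤ R * R ^ 3 := mul_le_mul_of_nonneg_right hz.2 (by positivity)
        nlinarith [sq_nonneg R]
      have h4 : b 0 z * (z / (1 + R ^ 2) ^ 2) ≤ M * (1 / R ^ 3) := by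
        have : 0 ≤ z / (1 + R ^ 2) ^ 2 := div_nonneg hz.1 (by positivity)
        exact mul_le_mul h2 h3 this hM
      simp only [truncatedWeight]
      linarith
    have i1 : IntervalIntegrable (fun z => b 0 z * layerWeight z) volume 0 R :=
      (c1.mul continuous_layerWeight.continuousOn).intervalIntegrable_of_Icc hR0
    have h2 := intervalIntegral.integral_mono_on (μ := volume) hR0
      (i1.sub intervalIntegrable_const)
      ((c1.mul continuous_truncatedWeight.continuousOn).intervalIntegrable_of_Icc hR0) h1
    rw [intervalIntegral.integral_sub i1 intervalIntegrable_const,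
      intervalIntegral.integral_const, sub_zero, smul_eq_mul] at h2
    have h3 : R * (M * (1 / R ^ 3)) ≤ 1 / 8 := by
      have : R * (M * (1 / R ^ 3)) = M / R ^ 2 := by field_simp
      rw [this, div_le_div_iff₀ (by positivity) (by norm_num)]
      nlinarith
    simp only [Pi.mul_apply] at h2
    linarith
  -- the height of the wall layer that is left out
  obtain ⟨ε, hε0, hε1, hεM, hεb, hεint⟩ : ∃ ε : ℝ, 0 < ε ∧ ε ≤ 1 ∧ M * ε ≤ 1 / 2 ∧
      (∀ t ∈ Ioo 0 τ, |b t ε| ≤ 1 / 4) ∧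
      (∫ z in (0 : ℝ)..R, b 0 z * truncatedWeight R z) - 1 / 2 ≤
        ∫ z in (0 : ℝ)..R, b 0 (ε + z) * truncatedWeight R z := by
    have e1 : ∀ᶠ ε : ℝ in 𝓝[>] 0, 0 < ε := self_mem_nhdsWithin
    have e2 : ∀ᶠ ε : ℝ in 𝓝[>] 0, ε ≤ 1 :=
      nhdsWithin_le_nhds (Iic_mem_nhds one_pos)
    have e3 : ∀ᶠ ε : ℝ in 𝓝[>] 0, M * ε ≤ 1 / 2 := by
      have : Tendsto (fun ε : ℝ => M * ε) (𝓝 0) (𝓝 (M * 0)) :=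
        (continuous_const.mul continuous_id).tendsto 0
      rw [mul_zero] at this
      exact nhdsWithin_le_nhds (this.eventually (Iic_mem_nhds (by norm_num)))
    have e4 : ∀ᶠ ε : ℝ in 𝓝[>] 0, ∀ t ∈ Ioo 0 τ, |b t ε| ≤ 1 / 4 := by
      have huc := (isCompact_Icc.prod isCompact_Icc).uniformContinuousOn_of_continuous
        (hbc.mono (prod_mono_right Icc_subset_Ici_self : Icc 0 τ ×ˢ Icc 0 (1 : ℝ) ⊆ _))
      obtain ⟨δ, hδ, hδ'⟩ := Metric.uniformContinuousOn_iff.1 huc (1 / 4) (by norm_num)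
      filter_upwards [e1, e2, Ioo_mem_nhdsGT hδ] with ε h1 h2 h3 t ht
      have := hδ' (t, ε) ⟨⟨ht.1.le, ht.2.le⟩, h1.le, h2⟩ (t, 0)
        ⟨⟨ht.1.le, ht.2.le⟩, le_rfl, zero_le_one⟩ (by
          rw [Prod.dist_eq, dist_self, Real.dist_eq, sub_zero, abs_of_pos h1]
          exact max_lt hδ h3.2)
      rw [Real.dist_eq] at this
      simp only [hb0 t ⟨ht.1.le, ht.2.le⟩, sub_zero] at this
      exact this.le
    have e5 : ∀ᶠ ε : ℝ in 𝓝[>] 0, (∫ z in (0 : ℝ)..R, b 0 z * truncatedWeight R z) - 1 / 2 ≤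
        ∫ z in (0 : ℝ)..R, b 0 (ε + z) * truncatedWeight R z := by
      have c1 : Continuous fun y => b 0 (max y 0) :=
        hb0c.comp_continuous (by fun_prop) fun y => mem_Ici.2 (le_max_right _ _)
      have c2 : Continuous fun ε : ℝ =>
          ∫ z in (0 : ℝ)..R, b 0 (max (ε + z) 0) * truncatedWeight R z := by
        refine intervalIntegral.continuous_parametric_intervalIntegral_of_continuous' ?_ 0 R
        exact (c1.comp (continuous_fst.add continuous_snd)).mul
          (continuous_truncatedWeight.comp continuous_snd)
      have c3 : ∀ ε : ℝ, 0 ≤ ε → ∫ z in (0 : ℝ)..R, b 0 (max (ε + z) 0) * truncatedWeight R z =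
          ∫ z in (0 : ℝ)..R, b 0 (ε + z) * truncatedWeight R z := by
        intro ε hε
        refine intervalIntegral.integral_congr fun z hz => ?_
        rw [uIcc_of_le hR0] at hz
        simp only [max_eq_left (add_nonneg hε hz.1)]
      have c4 := nhdsWithin_le_nhds (s := Ioi 0)
        ((c2.tendsto 0).eventually (lt_mem_nhds (sub_lt_self _ one_half_pos)))
      filter_upwards [c4, e1] with ε h1 h2
      rw [c3 ε h2.le, c3 0 le_rfl] at h1
      simpa using h1.le
    exact (e1.and (e2.and (e3.and (e4.and e5)))).exists
  have hpos : ∀ z ∈ Icc 0 R, 0 < ε + z := fun z hz => by linarith [hz.1]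
  have hcs : ∀ t ∈ Icc 0 τ, ContinuousOn (fun z => b t (ε + z) * truncatedWeight R z) (Icc 0 R) :=
    fun t ht => ContinuousOn.mul (hbc.comp (f := fun z : ℝ => (t, ε + z)) (by fun_prop)
      fun z hz => ⟨ht, (hpos z hz).le⟩) continuous_truncatedWeight.continuousOn
  refine false_of_riccati_of_large
    (F := fun t => ∫ z in (0 : ℝ)..R, b t (ε + z) * truncatedWeight R z)
    (F' := fun t => ∫ z in (0 : ℝ)..R, bt t (ε + z) * truncatedWeight R z) (C₁ := 73 + CP / 2)
    hτ (by linarith) ?_ ?_ ?_ ?_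
  · intro t ht
    obtain ⟨C, hC⟩ := isCompact_Icc.exists_bound_of_continuousOn
      (continuous_truncatedWeight (R := R)).continuousOn (s := Icc 0 R)
    have hI : uIoc 0 R ⊆ Icc 0 R := by
      rw [uIoc_of_le hR0]
      exact Ioc_subset_Icc_self
    refine intervalIntegral.continuousWithinAt_of_dominated_interval (bound := fun _ => M * C)
      ?_ ?_ intervalIntegrable_const ?_
    · filter_upwards [self_mem_nhdsWithin] with s hs
      exact ((hcs s ⟨hs.1, hs.2.le⟩).mono hI).aestronglyMeasurable measurableSet_uIoc
    · filter_upwards [self_mem_nhdsWithin] with s hs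
      refine Eventually.of_forall fun z hz => ?_
      rw [norm_mul]
      exact mul_le_mul (hbM s hs _ (hpos z (hI hz))) (hC z (hI hz)) (norm_nonneg _) hM
    · refine Eventually.of_forall fun z hz => ContinuousWithinAt.mul ?_ continuousWithinAt_const
      exact (hbc.comp (f := fun s : ℝ => (s, ε + z)) (s := Ico 0 τ) (by fun_prop)
        fun s hs => ⟨⟨hs.1, hs.2.le⟩, (hpos z (hI hz)).le⟩) t ht
  · intro t ht
    refine hasDerivAt_intervalIntegral_of_continuousOn hR0 ht
      (fun s hs => hcs s ⟨hs.1.le, hs.2.le⟩) ?_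
      fun s hs z hz => (hbt s hs _ (hpos z hz)).mul_const _
    refine ContinuousOn.mul ?_ (continuous_truncatedWeight.comp continuous_snd).continuousOn
    exact hbtc.comp (f := fun p : ℝ × ℝ => (p.1, ε + p.2)) (by fun_prop)
      fun p hp => ⟨hp.1, hpos _ hp.2⟩
  · intro t ht
    have h1 := truncated_functional_deriv_ge hM hCP hR1 hε0 hε1 (hbM t ⟨ht.1.le, ht.2⟩) (hvM t ht)
      (hv t ht) (hby t ht) (hbyy t ht) (hbyyc t ht)
      (hbtc.comp (f := fun y : ℝ => (t, y)) (by fun_prop) fun y hy => ⟨ht, hy⟩) (heq t ht) rfl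
    refine le_trans ?_ h1
    have h2 := hεb t ht
    have h3 : (4 * M + 4 * M ^ 2) / R ≤ 1 / 2 := by
      rw [div_le_div_iff₀ (by linarith) two_pos]
      linarith
    have h4 : M ^ 2 * ε ^ 2 / 2 ≤ 1 / 8 := by nlinarith [mul_nonneg hM hε0.le]
    linarith
  · linarith

/-! ### The boundary layer on the axis -/

/-- On the axis the outer flow is at rest and its temperature is constant in time, hence so is the
pressure gradient. -/
theorem IsOuterFlow.exists_axis_pressure_gradient {T θref : ℝ} {UE θE P : ℝ → ℝ → ℝ}
    (h : IsOuterFlow T θref UE θE P) (hU : ∀ t ∈ Icc 0 T, UE t 0 = 0) :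
    ∃ c, ∀ t ∈ Ioo 0 T, deriv (P t) 0 = c := by
  have hU' : ∀ t ∈ Ioo 0 T, deriv (fun s => UE s 0) t = 0 := by
    intro t ht
    have : (fun s => UE s 0) =ᶠ[𝓝 t] fun _ => 0 := by
      filter_upwards [Ioo_mem_nhds ht.1 ht.2] with s hs using hU s ⟨hs.1.le, hs.2.le⟩
    rw [this.deriv_eq, deriv_const]
  have hθd : ∀ t ∈ Ioo 0 T, HasDerivAt (fun s => θE s 0) 0 t := by
    intro t ht
    have h1 : ContDiffAt ℝ 2 (fun p : ℝ × ℝ => θE p.1 p.2) (t, 0) :=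
      h.contDiff_temperature.contDiffAt (prod_mem_nhds (Icc_mem_nhds ht.1 ht.2) univ_mem)
    have h2 : DifferentiableAt ℝ (fun s : ℝ => θE s 0) t :=
      (h1.differentiableAt (by simp)).comp t
        (f := fun s : ℝ => (s, (0 : ℝ))) (by fun_prop)
    have h3 := h.transport t ht 0
    rw [hU t ⟨ht.1.le, ht.2.le⟩, zero_mul, add_zero] at h3
    exact h2.hasDerivAt.congr_deriv h3
  obtain ⟨k, hk⟩ : ∃ k, ∀ t ∈ Ioo 0 T, θE t 0 = k := by
    rcases (Ioo (0 : ℝ) T).eq_empty_or_nonempty with he | ⟨s, hs⟩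
    · exact ⟨0, fun t ht => by simp [he] at ht⟩
    · exact ⟨θE s 0, fun t ht => isOpen_Ioo.is_const_of_deriv_eq_zero isPreconnected_Ioo
        (fun r hr => (hθd r hr).differentiableAt.differentiableWithinAt)
        (fun r hr => (hθd r hr).deriv) ht hs⟩
  refine ⟨θref - k, fun t ht => ?_⟩
  have := h.momentum t ht 0
  rw [hU' t ht, hU t ⟨ht.1.le, ht.2.le⟩, hk t ht] at this
  linarith

namespace IsThermalLayerSolution

variable {T θref τ M : ℝ} {UE θE P θb u₀ θ₀ : ℝ → ℝ → ℝ} {u v θ : ℝ → ℝ → ℝ → ℝ}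

theorem continuousOn_axis {f : ℝ → ℝ → ℝ → ℝ}
    (hf : ContinuousOn (fun p : ℝ × ℝ × ℝ => f p.1 p.2.1 p.2.2) (fullRegion T)) :
    ContinuousOn (fun p : ℝ × ℝ => f p.1 0 p.2) (Ico 0 T ×ˢ Ici 0) :=
  hf.comp (f := fun p : ℝ × ℝ => (p.1, (0 : ℝ), p.2)) (by fun_prop)
    fun p hp => ⟨hp.1, mem_univ _, hp.2⟩

theorem interior_u (h : IsThermalLayerSolution T θref UE θE P θb u₀ θ₀ u v θ) :
    InteriorContDiff T 3 u := h.contDiff_u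

theorem interior_θ (h : IsThermalLayerSolution T θref UE θE P θb u₀ θ₀ u v θ) :
    InteriorContDiff T 3 θ := h.contDiff_θ

theorem interior_v (h : IsThermalLayerSolution T θref UE θE P θb u₀ θ₀ u v θ) :
    InteriorContDiff T 1 v := h.contDiff_v

/-- The pressure gradient on the axis is constant up to and including the initial time. At `t = 0`
the outer equations say nothing; the value is transmitted by the continuity of `θ` at the corner
`t = y = 0`, through the condition on the wall temperature. -/
theorem axis_pressure_gradient_eq (h : IsThermalLayerSolution T θref UE θE P θb u₀ θ₀ u v θ)
    (hflow : IsOuterFlow T θref UE θE P)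
    (hs : SymmetrySignConditions T θref UE θE P θb u₀ θ₀) {t : ℝ} (ht : t ∈ Ico 0 T) :
    deriv (P t) 0 = deriv (P 0) 0 := by
  obtain ⟨c, hc⟩ := hflow.exists_axis_pressure_gradient hs.outer_velocity
  have hT : 0 < T := ht.1.trans_lt ht.2
  have hwall : ∀ s ∈ Ico 0 T, θ s 0 0 = θref - deriv (P s) 0 := by
    intro s hs'
    rw [h.wall_θ s hs' 0]
    linarith [hs.boundary_temperature s ⟨hs'.1, hs'.2.le⟩]
  have hcont : ContinuousOn (fun s => θ s 0 0) (Ico 0 T) :=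
    h.continuous_θ.comp (f := fun s : ℝ => (s, (0 : ℝ), (0 : ℝ))) (by fun_prop)
      fun s hs' => ⟨hs', mem_univ _, self_mem_Ici⟩
  have h0 : deriv (P 0) 0 = c := by
    have h1 : Tendsto (fun s => θ s 0 0) (𝓝[>] 0) (𝓝 (θ 0 0 0)) := by
      rw [← nhdsWithin_Ioo_eq_nhdsGT hT]
      exact (hcont 0 ⟨le_rfl, hT⟩).mono_left (nhdsWithin_mono _ Ioo_subset_Ico_self)
    have h2 : Tendsto (fun s => θ s 0 0) (𝓝[>] 0) (𝓝 (θref - c)) := by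
      refine tendsto_const_nhds.congr' ?_
      filter_upwards [Ioo_mem_nhdsGT hT] with s hs'
      rw [hwall s ⟨hs'.1.le, hs'.2⟩, hc s hs']
    have h3 := tendsto_nhds_unique h1 h2
    rw [hwall 0 ⟨le_rfl, hT⟩] at h3
    linarith
  rcases ht.1.eq_or_lt with h1 | h1
  · rw [← h1]
  · rw [hc t ⟨h1, ht.2⟩, h0]

theorem hasDerivAt_v (h : IsThermalLayerSolution T θref UE θE P θb u₀ θ₀ u v θ) {t y : ℝ}
    (ht : t ∈ Ioo 0 T) (hy : 0 < y) : HasDerivAt (v t 0) (-partialX u t 0 y) y := by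
  have h1 := h.interior_v.hasDerivAt_y (x := 0) ht hy
  have h2 := h.divergence_free t ht 0 y hy
  exact h1.congr_deriv (by linarith)

theorem abs_v_le (h : IsThermalLayerSolution T θref UE θE P θb u₀ θ₀ u v θ) {t y : ℝ}
    (ht : t ∈ Ioo 0 T) (hM : ∀ y, 0 < y → |partialX u t 0 y| ≤ M) (hy : 0 < y) :
    |v t 0 y| ≤ M * y := by
  refine abs_le_mul_of_hasDerivAt (h' := fun y => -partialX u t 0 y) ?_
    (h.wall_v t ⟨ht.1.le, ht.2⟩ 0) (fun y hy => h.hasDerivAt_v ht hy) (fun y hy => ?_) hy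
  · exact (continuousOn_axis h.continuous_v).comp (f := fun y : ℝ => (t, y)) (by fun_prop)
      fun y hy => ⟨⟨ht.1.le, ht.2⟩, hy⟩
  · rw [abs_neg]
    exact hM y hy

/-- On the axis the velocity stays zero and the temperature stays constant, as long as `∂ₓu` is
bounded there. -/
theorem axis_eq (h : IsThermalLayerSolution T θref UE θE P θb u₀ θ₀ u v θ)
    (hflow : IsOuterFlow T θref UE θE P)
    (hs : SymmetrySignConditions T θref UE θE P θb u₀ θ₀) (hτ : τ ∈ Ioo 0 T) (hM0 : 0 ≤ M)
    (hM : ∀ t ∈ Ico 0 τ, ∀ y, 0 < y → |partialX u t 0 y| ≤ M)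
    {t y : ℝ} (ht : t ∈ Ico 0 τ) (hy : 0 ≤ y) :
    u t 0 y = 0 ∧ θ t 0 y = θref - deriv (P 0) 0 := by
  obtain ⟨C, hC⟩ := h.bounded_on_axis τ hτ
  set c := θref - deriv (P 0) 0 with hc
  have hsub : ∀ {t}, t ∈ Ioo 0 τ → t ∈ Ioo 0 T := fun ht => ⟨ht.1, ht.2.trans hτ.2⟩
  have hsub' : ∀ {t}, t ∈ Ico 0 τ → t ∈ Ico 0 T := fun ht => ⟨ht.1, ht.2.trans hτ.2⟩
  have hCN : C ≤ |C| + |c| := by linarith [le_abs_self C, abs_nonneg c]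
  have hmono : Ico 0 τ ×ˢ Ici (0 : ℝ) ⊆ Ico 0 T ×ˢ Ici 0 := prod_mono_left fun t ht => hsub' ht
  have hu3 := h.interior_u
  have hθ3 := h.interior_θ
  have hu1 : InteriorContDiff T 1 u := hu3.of_le (by norm_num)
  have hθ1 : InteriorContDiff T 1 θ := hθ3.of_le (by norm_num)
  have huy : InteriorContDiff T 1 (partialY u) :=
    InteriorContDiff.partialY (hu3.of_le (by norm_num))
  have hθy : InteriorContDiff T 1 (partialY θ) :=
    InteriorContDiff.partialY (hθ3.of_le (by norm_num))
  have key := axis_system_eq_zero (τ := τ) (M := M) (N := |C| + |c|) (w := fun t y => u t 0 y)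
    (wt := fun t y => partialT u t 0 y) (wy := fun t y => partialY u t 0 y)
    (wyy := fun t y => partialY (partialY u) t 0 y) (Θ := fun t y => θ t 0 y - c)
    (Θt := fun t y => partialT θ t 0 y) (Θy := fun t y => partialY θ t 0 y)
    (Θyy := fun t y => partialY (partialY θ) t 0 y) (a := fun t y => partialX u t 0 y)
    (η := fun t y => partialX θ t 0 y) (v := fun t y => v t 0 y) hM0 (by positivity)
    (fun t ht y hy => h.abs_v_le (hsub ht) (hM t ⟨ht.1.le, ht.2⟩) hy)
    ((continuousOn_axis h.continuous_u).mono hmono)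
    (((continuousOn_axis h.continuous_θ).mono hmono).sub continuousOn_const)
    (fun y hy => by rw [h.initial_u 0 y hy, hs.initial_velocity y hy])
    (fun t ht => h.wall_u t (hsub' ht) 0)
    (fun y hy => by
      rw [h.initial_θ 0 y hy]
      linarith [hs.initial_temperature y hy])
    (fun t ht => by
      have h1 := hs.boundary_temperature t ⟨ht.1, (hsub' ht).2.le⟩
      rw [h.axis_pressure_gradient_eq hflow hs (hsub' ht)] at h1
      rw [h.wall_θ t (hsub' ht) 0]
      linarith)
    (fun t ht y hy => hM t ⟨ht.1.le, ht.2⟩ y hy)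
    (fun t ht y hy => (hC t ⟨ht.1, ht.2.le⟩ y hy).2.1.trans hCN)
    (fun t ht y hy => (abs_sub _ _).trans
      (add_le_add_left ((hC t ⟨ht.1, ht.2.le⟩ y hy).1.trans (le_abs_self C)) _))
    (fun t ht y hy => (hC t ⟨ht.1, ht.2.le⟩ y hy).2.2.trans hCN)
    (fun t ht y hy => hu1.hasDerivAt_t (hsub ht) hy)
    (fun t ht y hy => hu1.hasDerivAt_y (hsub ht) hy)
    (fun t ht y hy => huy.hasDerivAt_y (hsub ht) hy)
    (fun t ht y hy => (hθ1.hasDerivAt_t (hsub ht) hy).sub_const _)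
    (fun t ht y hy => (hθ1.hasDerivAt_y (hsub ht) hy).sub_const _)
    (fun t ht y hy => hθy.hasDerivAt_y (hsub ht) hy)
    (fun t ht y hy => by
      have h1 := h.momentum t (hsub ht) 0 y hy
      rw [h.axis_pressure_gradient_eq hflow hs ⟨ht.1.le, (hsub ht).2⟩] at h1
      linarith)
    (fun t ht y hy => h.heat t (hsub ht) 0 y hy) ht hy
  exact ⟨key.1, sub_eq_zero.1 key.2⟩

/-- The momentum equation differentiated in `x` at a point of the axis where `u` and `∂_y u`
vanish. -/
theorem axis_slope_equation (h : IsThermalLayerSolution T θref UE θE P θb u₀ θ₀ u v θ) {t y : ℝ}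
    (ht : t ∈ Ioo 0 T) (hy : 0 < y) (hu : u t 0 y = 0) (huy : partialY u t 0 y = 0) :
    partialT (partialX u) t 0 y + partialX u t 0 y ^ 2 + v t 0 y * partialY (partialX u) t 0 y =
      partialY (partialY (partialX u)) t 0 y - deriv (deriv (P t)) 0 - partialX θ t 0 y := by
  have hu3 := h.interior_u
  have hu1 : InteriorContDiff T 1 u := hu3.of_le (by norm_num)
  have hu2 : InteriorContDiff T 2 u := hu3.of_le (by norm_num)
  have hθ1 : InteriorContDiff T 1 θ := h.interior_θ.of_le (by norm_num)
  have hut : InteriorContDiff T 1 (partialT u) :=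
    InteriorContDiff.partialT (hu3.of_le (by norm_num))
  have hux : InteriorContDiff T 1 (partialX u) :=
    InteriorContDiff.partialX (hu3.of_le (by norm_num))
  have huY : InteriorContDiff T 1 (partialY u) :=
    InteriorContDiff.partialY (hu3.of_le (by norm_num))
  have huYY : InteriorContDiff T 1 (partialY (partialY u)) :=
    InteriorContDiff.partialY (InteriorContDiff.partialY (hu3.of_le (by norm_num)))
  have hP : deriv (P t) = fun x => partialY (partialY u) t x y - (θ t x y - θref) -
      (partialT u t x y + u t x y * partialX u t x y + v t x y * partialY u t x y) := by
    funext x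
    linarith [h.momentum t ht x y hy]
  have h1 := ((huYY.hasDerivAt_x (x := 0) ht hy).sub ((hθ1.hasDerivAt_x (x := 0) ht hy).sub_const
    θref)).sub (((hut.hasDerivAt_x (x := 0) ht hy).add ((hu1.hasDerivAt_x (x := 0) ht hy).mul
    (hux.hasDerivAt_x (x := 0) ht hy))).add ((h.interior_v.hasDerivAt_x (x := 0) ht hy).mul
    (huY.hasDerivAt_x (x := 0) ht hy)))
  have h2 := (h1.congr_of_eventuallyEq (Eventually.of_forall fun x => congrFun hP x)).deriv
  rw [hu, huy, hu2.partialX_partialT ht hy, hu2.partialX_partialY ht hy,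
    hu3.partialX_partialY_partialY ht hy] at h2
  linarith

/-- The heat equation differentiated in `x` at a point of the axis; the dissipation `(∂_y u)²` drops
out, since its derivative is a multiple of `∂_y u`. -/
theorem axis_heat_slope_equation (h : IsThermalLayerSolution T θref UE θE P θb u₀ θ₀ u v θ)
    {t y : ℝ} (ht : t ∈ Ioo 0 T) (hy : 0 < y) (hu : u t 0 y = 0) (huy : partialY u t 0 y = 0)
    (hθy : partialY θ t 0 y = 0) :
    partialT (partialX θ) t 0 y + partialX u t 0 y * partialX θ t 0 y +
        v t 0 y * partialY (partialX θ) t 0 y =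
      partialY (partialY (partialX θ)) t 0 y := by
  have hθ3 := h.interior_θ
  have hu1 : InteriorContDiff T 1 u := h.interior_u.of_le (by norm_num)
  have hθ2 : InteriorContDiff T 2 θ := hθ3.of_le (by norm_num)
  have hut : InteriorContDiff T 1 (partialT θ) :=
    InteriorContDiff.partialT (hθ3.of_le (by norm_num))
  have hux : InteriorContDiff T 1 (partialX θ) :=
    InteriorContDiff.partialX (hθ3.of_le (by norm_num))
  have hθY : InteriorContDiff T 1 (partialY θ) :=
    InteriorContDiff.partialY (hθ3.of_le (by norm_num))
  have huY : InteriorContDiff T 1 (partialY u) :=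
    InteriorContDiff.partialY (h.interior_u.of_le (by norm_num))
  have hθYY : InteriorContDiff T 1 (partialY (partialY θ)) :=
    InteriorContDiff.partialY (InteriorContDiff.partialY (hθ3.of_le (by norm_num)))
  have h1 := ((hut.hasDerivAt_x (x := 0) ht hy).add ((hu1.hasDerivAt_x (x := 0) ht hy).mul
    (hux.hasDerivAt_x (x := 0) ht hy))).add ((h.interior_v.hasDerivAt_x (x := 0) ht hy).mul
    (hθY.hasDerivAt_x (x := 0) ht hy))
  have h2 := (hθYY.hasDerivAt_x (x := 0) ht hy).add ((huY.hasDerivAt_x (x := 0) ht hy).pow 2)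
  have h3 := h1.unique (h2.congr_of_eventuallyEq
    (Eventually.of_forall fun x => h.heat t ht x y hy))
  rw [hu, huy, hθy, hθ2.partialX_partialT ht hy, hθ2.partialX_partialY ht hy,
    hθ3.partialX_partialY_partialY ht hy] at h3
  norm_num at h3
  linarith

theorem axis_partialY_eq_zero (h : IsThermalLayerSolution T θref UE θE P θb u₀ θ₀ u v θ)
    (hflow : IsOuterFlow T θref UE θE P)
    (hs : SymmetrySignConditions T θref UE θE P θb u₀ θ₀) (hτ : τ ∈ Ioo 0 T) (hM0 : 0 ≤ M)
    (hM : ∀ t ∈ Ico 0 τ, ∀ y, 0 < y → |partialX u t 0 y| ≤ M)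
    {t y : ℝ} (ht : t ∈ Ico 0 τ) (hy : 0 < y) :
    partialY u t 0 y = 0 ∧ partialY θ t 0 y = 0 := by
  have key : ∀ z, 0 < z → u t 0 z = 0 ∧ θ t 0 z = θref - deriv (P 0) 0 := fun z hz =>
    h.axis_eq hflow hs hτ hM0 hM ht hz.le
  constructor
  · have : (fun z => u t 0 z) =ᶠ[𝓝 y] fun _ => 0 :=
      (lt_mem_nhds hy).mono fun z hz => (key z hz).1
    exact this.deriv_eq.trans (deriv_const _ _)
  · have : (fun z => θ t 0 z) =ᶠ[𝓝 y] fun _ => θref - deriv (P 0) 0 :=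
      (lt_mem_nhds hy).mono fun z hz => (key z hz).2
    exact this.deriv_eq.trans (deriv_const _ _)

/-- The maximum principle for `∂ₓθ` on the axis. -/
theorem axis_temperature_slope_nonneg
    (h : IsThermalLayerSolution T θref UE θE P θb u₀ θ₀ u v θ)
    (hflow : IsOuterFlow T θref UE θE P)
    (hs : SymmetrySignConditions T θref UE θE P θb u₀ θ₀) (hτ : τ ∈ Ioo 0 T) (hM0 : 0 ≤ M)
    (hM : ∀ t ∈ Ico 0 τ, ∀ y, 0 < y → |partialX u t 0 y| ≤ M)
    {t y : ℝ} (ht : t ∈ Ico 0 τ) (hy : 0 ≤ y) : 0 ≤ partialX θ t 0 y := by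
  obtain ⟨C, hC⟩ := h.bounded_on_axis τ hτ
  have hsub : ∀ {t}, t ∈ Ioo 0 τ → t ∈ Ioo 0 T := fun ht => ⟨ht.1, ht.2.trans hτ.2⟩
  have hsub' : ∀ {t}, t ∈ Ico 0 τ → t ∈ Ico 0 T := fun ht => ⟨ht.1, ht.2.trans hτ.2⟩
  have hηx : InteriorContDiff T 1 (partialX θ) :=
    InteriorContDiff.partialX (h.interior_θ.of_le (by norm_num))
  have hηxy : InteriorContDiff T 1 (partialY (partialX θ)) :=
    InteriorContDiff.partialY (InteriorContDiff.partialX (h.interior_θ.of_le (by norm_num)))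
  have key : -partialX θ t 0 y ≤ 0 := by
    refine parabolic_maximum_principle (A := M) (C := |C|) (B := M) (v := fun t y => v t 0 y)
      (f := fun t y => -partialX θ t 0 y) (ft := fun t y => -partialT (partialX θ) t 0 y)
      (fy := fun t y => -partialY (partialX θ) t 0 y)
      (fyy := fun t y => -partialY (partialY (partialX θ)) t 0 y) hM0
      (fun t ht y hy => h.abs_v_le (hsub ht) (hM t ⟨ht.1.le, ht.2⟩) hy)
      ((continuousOn_axis h.continuous_partialX_θ).mono (prod_mono_left fun t ht => hsub' ht)).neg
      ?_ ?_ ?_ (fun t ht y hy => (hηx.hasDerivAt_t (hsub ht) hy).neg)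
      (fun t ht y hy => (hηx.hasDerivAt_y (hsub ht) hy).neg)
      (fun t ht y hy => (hηxy.hasDerivAt_y (hsub ht) hy).neg) ?_ ht hy
    · intro t ht y hy
      have h1 := (neg_le_abs _).trans (hC t ⟨ht.1, ht.2.le⟩ y hy).2.1
      nlinarith [le_abs_self C, abs_nonneg C]
    · intro y hy
      have h1 : partialX θ 0 0 y = deriv (fun x => θ₀ x y) 0 := by
        unfold partialX
        congr 1
        funext x
        exact h.initial_θ x y hy
      simp only [h1]
      linarith [hs.initial_temperature_slope y hy]
    · intro t ht
      have h1 : partialX θ t 0 0 = deriv (θb t) 0 := by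
        unfold partialX
        congr 1
        funext x
        exact h.wall_θ t (hsub' ht) x
      simp only [h1]
      linarith [hs.boundary_temperature_slope t ⟨ht.1, (hsub' ht).2.le⟩]
    · intro t ht y hy hpos
      have ht' : t ∈ Ico 0 τ := ⟨ht.1.le, ht.2⟩
      have h1 := h.axis_partialY_eq_zero hflow hs hτ hM0 hM ht' hy
      have h2 := h.axis_heat_slope_equation (hsub ht) hy
        (h.axis_eq hflow hs hτ hM0 hM ht' hy.le).1 h1.1 h1.2
      have h3 := mul_le_mul_of_nonneg_right (neg_le_of_abs_le (hM t ht' y hy)) hpos.le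
      linarith
  linarith

end IsThermalLayerSolution

/-! ### Blow-up -/

theorem theorem2p1 :
    ∃ 𝒴 : ℝ → ℝ, ContinuousOn 𝒴 (Ici 0) ∧ (∀ y : ℝ, 0 < y → 0 < 𝒴 y) ∧
      IntegrableOn 𝒴 (Ioi 0) ∧
      ∀ T CE CP : ℝ, 0 < T → 0 ≤ CE → 0 ≤ CP →
        ∃ K : ℝ, ∀ (θref : ℝ) (UE θE P θb u₀ θ₀ : ℝ → ℝ → ℝ) (u v θ : ℝ → ℝ → ℝ → ℝ),
          0 < θref →
          IsOuterFlow T θref UE θE P →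
          SymmetrySignConditions T θref UE θE P θb u₀ θ₀ →
          (∀ t ∈ Icc 0 T, deriv (UE t) 0 ≤ CE) →
          (∀ t ∈ Icc 0 T, - deriv (deriv (P t)) 0 ≤ CP) →
          IsThermalLayerSolution T θref UE θE P θb u₀ θ₀ u v θ →
          K ≤ ∫ y in Ioi (0 : ℝ), (- deriv (fun x => u₀ x y) 0) * 𝒴 y →
          ∃ tstar ∈ Ioo 0 T, ∀ M : ℝ, ∃ t ∈ Ico 0 tstar, ∃ y : ℝ, 0 < y ∧
            M < |partialX u t 0 y| := by
  refine ⟨layerWeight, continuous_layerWeight.continuousOn, fun y hy => layerWeight_pos hy,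
    integrableOn_layerWeight, fun T CE CP hT _ hCP => ⟨8 / (T / 2) + 4 * (73 + CP / 2) + 3, ?_⟩⟩
  intro θref UE θE P θb u₀ θ₀ u v θ _ hflow hs _ hP h hK
  -- the slope is unbounded already before time `T / 2`
  have hτ0 : 0 < T / 2 := by linarith
  have hτ : T / 2 ∈ Ioo 0 T := ⟨hτ0, by linarith⟩
  refine ⟨T / 2, hτ, ?_⟩
  by_contra! hbdd
  obtain ⟨M, hM⟩ := hbdd
  have hM0 : 0 ≤ M := (abs_nonneg _).trans (hM 0 ⟨le_rfl, hτ0⟩ 1 one_pos)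
  have hsub : ∀ {t}, t ∈ Ioo 0 (T / 2) → t ∈ Ioo 0 T := fun ht => ⟨ht.1, ht.2.trans hτ.2⟩
  have ha2 : InteriorContDiff T 2 (partialX u) :=
    InteriorContDiff.partialX (h.interior_u.of_le (by norm_num))
  have ha1 : InteriorContDiff T 1 (partialX u) := ha2.of_le (by norm_num)
  have hat : InteriorContDiff T 1 (partialT (partialX u)) :=
    InteriorContDiff.partialT (ha2.of_le (by norm_num))
  have hay : InteriorContDiff T 1 (partialY (partialX u)) :=
    InteriorContDiff.partialY (ha2.of_le (by norm_num))
  have hayy : InteriorContDiff T 0 (partialY (partialY (partialX u))) :=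
    InteriorContDiff.partialY (hay.of_le (by norm_num))
  refine not_lt_of_ge hK ?_
  have key := axis_slope_mass_lt (τ := T / 2) (M := M) (CP := CP)
    (b := fun t y => -partialX u t 0 y) (bt := fun t y => -partialT (partialX u) t 0 y)
    (b_y := fun t y => -partialY (partialX u) t 0 y)
    (byy := fun t y => -partialY (partialY (partialX u)) t 0 y) (v := fun t y => v t 0 y)
    hτ0 hM0 hCP
    ((IsThermalLayerSolution.continuousOn_axis h.continuous_partialX_u).mono
      (prod_mono_left fun t ht => ⟨ht.1, ht.2.trans_lt hτ.2⟩)).neg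
    (fun t ht => by
      have : (fun x => u t x 0) = fun _ => 0 :=
        funext fun x => h.wall_u t ⟨ht.1, ht.2.trans_lt hτ.2⟩ x
      simp [partialX, this])
    (fun t ht y hy => by rw [abs_neg]; exact hM t ht y hy)
    (fun t ht y hy => h.abs_v_le (hsub ht) (hM t ⟨ht.1.le, ht.2⟩) hy)
    (fun t ht y hy => h.hasDerivAt_v (hsub ht) hy)
    (fun t ht y hy => (ha1.hasDerivAt_t (hsub ht) hy).neg)
    (fun t ht y hy => (ha1.hasDerivAt_y (hsub ht) hy).neg)
    (fun t ht y hy => (hay.hasDerivAt_y (hsub ht) hy).neg)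
    ((ContDiffOn.continuousOn hat).comp (f := fun p : ℝ × ℝ => (p.1, (0 : ℝ), p.2)) (by fun_prop)
      fun p hp => mem_openRegion (hsub hp.1) hp.2).neg
    (fun t ht => ((ContDiffOn.continuousOn hayy).comp (f := fun y : ℝ => (t, (0 : ℝ), y))
      (by fun_prop) fun y hy => mem_openRegion (hsub ht) hy).neg)
    (fun t ht y hy => by
      have ht' : t ∈ Ico 0 (T / 2) := ⟨ht.1.le, ht.2⟩
      have h1 := h.axis_slope_equation (hsub ht) hy (h.axis_eq hflow hs hτ hM0 hM ht' hy.le).1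
        (h.axis_partialY_eq_zero hflow hs hτ hM0 hM ht' hy).1
      have h2 := hP t ⟨ht.1.le, (hsub ht).2.le⟩
      have h3 := h.axis_temperature_slope_nonneg hflow hs hτ hM0 hM ht' hy.le
      linarith)
  refine lt_of_eq_of_lt ?_ key
  refine setIntegral_congr_fun measurableSet_Ioi fun y hy => ?_
  have : (fun x => u₀ x y) = fun x => u 0 x y :=
    funext fun x => (h.initial_u x y (le_of_lt hy)).symm
  simp only [this, partialX]
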